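/- **Setting.** Let $k\ge 1$, let $\mathcal K\subset\mathbb R^k$ be compact, and let $\mathbb D$ be the set of probability distributions on $\mathcal K$ that have a Lebesgue density. For $P,Q\in\mathbb D$ with densities $p,q$ put $D(P,Q)=\int|p-q|$. Let $\mathcal P$ be a probability measure on $\mathbb D$, $\Phi_P(t)=\mathcal P(\{Q\in\mathbb D: D(Q,P)\le t\})$, and let $f:\mathbb D\to\mathbb R$ be measurable. Let $m\ge1$. The units $(P_i,(X_{ij})_{1\le j\le n_i},Y_i)$, $i=1,\dots,m+1$, are independent; $P_i\sim\mathcal P$; given $P_i$ the points $X_{i1},\dots,X_{in_i}$ are i.i.d. with law $P_i$; and $Y_i=f(P_i)+\mu_i$ with $\mathbb E[\mu_i\mid P_i]=0$. Write $P=P_{m+1}$ and $n=\min_{1\le i\le m+1}n_i\ge1$. **Estimator.** Let $B$ be a bounded measurable kernel with compact support and $\int_{\mathbb R^k}B(\|x\|)\,dx=1$, let $b=n^{-1/(2+k)}$, let $$\hat p_i(x)=\frac1{n_i}\sum_{j=1}^{n_i}\frac1{b^k}B\Big(\frac{\|x-X_{ij}\|}{b}\Big),\qquad i=1,\dots,m+1,$$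 and let $\hat p=\hat p_{m+1}$. For a bandwidth $h>0$ and a kernel $K$ put $\hat K_i=K(\|\hat p_i-\hat p\|_{L_1}/h)$ and $$\hat f(\hat P;\hat P_1,\dots,\hat P_m)=\frac{\sum_{i=1}^m Y_i\hat K_i}{\sum_{i=1}^m\hat K_i}\ \text{ if }\sum_{i=1}^m\hat K_i>0,\quad\text{and } 0 \text{ otherwise}.$$ **Assumptions.** - $|f(P)-f(Q)|\le L\,D(P,Q)^\beta$ for all $P,Q\in\mathbb D$, where $L>0$ and $0<\beta\le1$. - $K:[0,\infty)\to[0,\infty)$ is Lipschitz with constant $L_K$, and $\underline K\,\mathbf 1_{\{x\le r\}}\le K(x)\le\mathbf 1_{\{x\le R\}}$ for all $x>0$, where $0<\underline K<1$ and $0<r<R<\infty$. - $\mathcal P$-almost every $P$ has a density on $\mathbb R^k$ that is Lipschitz with constant $\Lambda$. - $|f|\le f_{\max}$ $\mathcal P$-almost surely, and $|Y_i|\le B_Y$ almost surely for every $i$. - $C_*n^{-1/(2+k)}\le rh/4$, where $C_*>0$ is a given constant. **Theorem.** For every $C_*>0$ there are constants $C_1,C_2,C_3,C_4>0$, depending only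 on $k,\mathcal K,\Lambda,B,L_K,\underline K,r,R,L,\beta,f_{\max},B_Y,C_*$, such that whenever the above assumptions hold, $$\mathbb E\big|\hat f(\hat P;\hat P_1,\dots,\hat P_m)-f(P)\big|\le \frac1h\,\mathbb E\Big[\frac1{\Phi_P(rh/2)}\Big]C_1n^{-\frac1{2+k}}+C_2h^\beta+C_3\sqrt{\frac1m}\sqrt{\mathbb E\Big[\frac1{\Phi_P(rh/2)}\Big]}+\frac{C_4}{m}\mathbb E\Big[\frac1{\Phi_P(rh/2)}\Big]+(m+1)e^{-\frac12n^{k/(2+k)}},$$ where $\mathbb E[1/\Phi_P(rh/2)]=\int\Phi_P(rh/2)^{-1}\,d\mathcal P(P)\in[1,\infty]$. -/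

import Mathlib

open MeasureTheory ProbabilityTheory
open scoped NNReal ENNReal

namespace DistReg

noncomputable section

/-- `ℝᵏ` with the Euclidean norm (and Lebesgue measure as `volume`). -/
abbrev E (k : ℕ) : Type := EuclideanSpace ℝ (Fin k)

/-- The set `𝔻` of all probability distributions on `𝒦 ⊆ ℝᵏ` that have a density with respect to
Lebesgue measure. -/
def Distn {k : ℕ} (𝒦 : Set (E k)) : Type :=
  {P : Measure (E k) // IsProbabilityMeasure P ∧ P 𝒦ᶜ = 0 ∧ P ≪ volume}

/-- `𝔻` carries the σ-algebra generated by the evaluations `P ↦ P A`, `A` Borel. -/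
instance {k : ℕ} (𝒦 : Set (E k)) : MeasurableSpace (Distn 𝒦) :=
  inferInstanceAs (MeasurableSpace
    {P : Measure (E k) // IsProbabilityMeasure P ∧ P 𝒦ᶜ = 0 ∧ P ≪ volume})

/-- The probability measure underlying an element of `𝔻`. -/
def Distn.toMeasure {k : ℕ} {𝒦 : Set (E k)} (P : Distn 𝒦) : Measure (E k) := P.1

/-- The Lebesgue density of `P ∈ 𝔻`. -/
def Distn.density {k : ℕ} {𝒦 : Set (E k)} (P : Distn 𝒦) (x : E k) : ℝ :=
  (P.toMeasure.rnDeriv volume x).toReal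

/-- The `L₁` distance `∫ |p(x) - q(x)| dx` of two functions on `ℝᵏ`. -/
def L1dist {k : ℕ} (p q : E k → ℝ) : ℝ := ∫ x, |p x - q x|

/-- `D(P, Q)`: the `L₁` distance of the densities of `P, Q ∈ 𝔻`. -/
def D {k : ℕ} {𝒦 : Set (E k)} (P Q : Distn 𝒦) : ℝ := L1dist P.density Q.density

/-- The small ball probability `Φ_P(t) = ν({Q ∈ 𝔻 : D(Q, P) ≤ t})`. -/
def smallBall {k : ℕ} {𝒦 : Set (E k)} (ν : Measure (Distn 𝒦)) (P : Distn 𝒦) (t : ℝ) : ℝ≥0∞ :=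
  ν {Q | D Q P ≤ t}

/-- `E[1 / Φ_P(t)]` for `P ∼ ν`, as an extended nonnegative number. -/
def invSmallBall {k : ℕ} {𝒦 : Set (E k)} (ν : Measure (Distn 𝒦)) (t : ℝ) : ℝ≥0∞ :=
  ∫⁻ P, (smallBall ν P t)⁻¹ ∂ν

/-- Hölder continuity of a functional on `𝔻`, with constant `L` and exponent `β`, in the metric
`D`. -/
def IsHolderFunctional {k : ℕ} {𝒦 : Set (E k)} (L β : ℝ) (f : Distn 𝒦 → ℝ) : Prop :=
  ∀ P Q : Distn 𝒦, |f P - f Q| ≤ L * D P Q ^ β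

/-- `P` has a density on `ℝᵏ` that is `1`-smooth Hölder, that is, Lipschitz, with constant `Λ`. -/
def HasHolderDensity {k : ℕ} {𝒦 : Set (E k)} (Λ : ℝ≥0) (P : Distn 𝒦) : Prop :=
  ∃ p : E k → ℝ, (∀ x, 0 ≤ p x) ∧ LipschitzWith Λ p ∧
    P.toMeasure = volume.withDensity (fun x => ENNReal.ofReal (p x))

/-- The regression kernel `K` on `[0, ∞)`: nonnegative, Lipschitz with constant `LK`, and
`κ · 1{x ∈ B(0, r)} ≤ K x ≤ 1{x ∈ B(0, R)}` for all `x > 0`. -/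
structure IsBoxedKernel (K : ℝ → ℝ) (LK : ℝ≥0) (κ r R : ℝ) : Prop where
  nonneg : ∀ x, 0 ≤ x → 0 ≤ K x
  lipschitz : LipschitzOnWith LK K (Set.Ici 0)
  lower : ∀ x, 0 < x → κ * (Metric.closedBall (0 : ℝ) r).indicator 1 x ≤ K x
  upper : ∀ x, 0 < x → K x ≤ (Metric.closedBall (0 : ℝ) R).indicator 1 x

/-- The smoothing kernel `B` of the density estimators: measurable, bounded, compactly supported,
with `x ↦ B(‖x‖)` integrating to one over `ℝᵏ`. -/
structure IsSmoothingKernel (k : ℕ) (B : ℝ → ℝ) : Prop where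
  measurable : Measurable B
  bounded : ∃ M, ∀ u, 0 ≤ u → |B u| ≤ M
  compactSupport : ∃ ρ, ∀ u, ρ < u → B u = 0
  integral_eq_one : ∫ x : E k, B ‖x‖ = 1

/-- The kernel density estimator with kernel `B` and bandwidth `b` from the sample
`X₁, …, X_N`. -/
def kde {k N : ℕ} (B : ℝ → ℝ) (b : ℝ) (X : Fin N → E k) (x : E k) : ℝ :=
  (1 / (N : ℝ)) * ∑ j, (1 / b ^ k) * B (‖x - X j‖ / b)

/-- The kernel regression estimate with distances `d i` to the training points, responses `y i`,
kernel `K` and bandwidth `h`; it is `0` if no training point gets positive weight. -/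
def kernelRegression {m : ℕ} (K : ℝ → ℝ) (h : ℝ) (d y : Fin m → ℝ) : ℝ :=
  if 0 < ∑ i, K (d i / h) then (∑ i, y i * K (d i / h)) / ∑ i, K (d i / h) else 0

/-- The kernel-kernel estimator `f̂(P̂; P̂₁, …, P̂ₘ)` from the samples `X 0, …, X m` and the
responses `y`. Indices `i.castSucc`, `i : Fin m`, are the training units; the last index `m` is
the new unit, whose response is not used. -/
def kernelKernel {k m : ℕ} {N : Fin (m + 1) → ℕ} (K B : ℝ → ℝ) (h b : ℝ)
    (X : (i : Fin (m + 1)) → Fin (N i) → E k) (y : Fin (m + 1) → ℝ) : ℝ :=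
  kernelRegression K h
    (fun i : Fin m => L1dist (kde B b (X i.castSucc)) (kde B b (X (Fin.last m))))
    (fun i : Fin m => y i.castSucc)

/-- The distribution regression model. The units `(Pᵢ, (Xᵢⱼ)ⱼ, Yᵢ)` are independent, `Pᵢ ∼ ν`,
given `Pᵢ` the points `Xᵢ₁, …, Xᵢ_{Nᵢ}` are i.i.d. with law `Pᵢ`, and the noise `Yᵢ - f(Pᵢ)` has
mean zero given `Pᵢ`. -/
structure IsModel {k : ℕ} {𝒦 : Set (E k)} {Ω : Type*} [MeasurableSpace Ω] (μ : Measure Ω)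
    (ν : Measure (Distn 𝒦)) (f : Distn 𝒦 → ℝ) {m : ℕ} (N : Fin (m + 1) → ℕ)
    (P : Fin (m + 1) → Ω → Distn 𝒦) (X : (i : Fin (m + 1)) → Fin (N i) → Ω → E k)
    (Y : Fin (m + 1) → Ω → ℝ) : Prop where
  measurable_P : ∀ i, Measurable (P i)
  measurable_X : ∀ i j, Measurable (X i j)
  measurable_Y : ∀ i, Measurable (Y i)
  indep : iIndepFun (β := fun i : Fin (m + 1) => Distn 𝒦 × (Fin (N i) → E k) × ℝ)
    (fun i ω => (P i ω, (fun j => X i j ω), Y i ω)) μ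
  law : ∀ i, ∀ A : Set (Distn 𝒦), MeasurableSet A →
    ∀ S : Fin (N i) → Set (E k), (∀ j, MeasurableSet (S j)) →
      μ {ω | P i ω ∈ A ∧ ∀ j, X i j ω ∈ S j} = ∫⁻ Q in A, ∏ j, Q.toMeasure (S j) ∂ν
  noise : ∀ i, μ[fun ω => Y i ω - f (P i ω) | MeasurableSpace.comap (P i) inferInstance] =ᵐ[μ] 0

end

end DistReg

/-! Compare the estimator with the oracle kernel regression that uses the true distances `D (P i) P`
in place of the estimated ones. Let `t = r * h` and let `c` be the number of training units within
`t` of the new one. If `c > 0`, the error splits into three pieces. The change of distances costs at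
most a multiple of `(1 / h) * ∑ (e i + e₀) / c`, where `e i`, `e₀` are the L₁ errors of the density
estimators (`abs_kernelRegression_sub_le`). The Hölder bias is `O(h ^ β)`, because `K` vanishes
beyond `R`. The noise is a weighted sum with squared weights summing to `O(1 / c)`. If `c = 0`,
boundedness alone is used.

The difficulty is that `1 / c` depends on every unit. It is replaced by `invRank`, the inverse of
one plus the count with unit `i` left out: at most a factor 2 is lost, and `invRank` at `i` is
independent of unit `i`. Multiplying it by the probability `Φ` that unit `i` is a neighbour
therefore gives the expectation of `1{d i ≤ t} * invRank`, and these variables sum to at most 1.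
Hence `E ∑ invRank ≤ E[1 / Φ]` (`mul_lintegral_sum_invRank_le`). This single inequality controls the
density errors, the noise and the event `c = 0`; for the last two, some index carries at most the
average `E[1 / Φ] / m`.

The density errors enter only through their conditional means given `P i`, which are `O(b)` for
Lipschitz densities (`exists_lintegral_L1dist_kde_le`). `IsModel.lintegral_abs_kernelKernel_sub_le`
assembles the pieces. -/

namespace DistReg

/-! ### Fubini for independent families by resampling one coordinate -/

section Resampling

variable {Ω ι α : Type*} [DecidableEq ι] [MeasurableSpace Ω] [MeasurableSpace α]
  {μ : Measure Ω} [IsProbabilityMeasure μ] {V : ι → Ω → α}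

theorem measurable_resample (hV : ∀ i, Measurable (V i)) (i : ι) :
    Measurable fun z : Ω × Ω => Function.update (fun l => V l z.1) i (V i z.2) := by
  refine measurable_pi_lambda _ fun l => ?_
  by_cases h : l = i
  · subst h
    simp only [Function.update_self]
    exact (hV l).comp measurable_snd
  · simp only [Function.update_of_ne h]
    exact (hV l).comp measurable_fst

variable [Fintype ι]

/-- Replacing one coordinate of an independent family by an independent copy of it does not change
the joint law. -/
theorem map_resample (hV : ∀ i, Measurable (V i)) (hind : iIndepFun V μ) (i : ι) :
    (μ.prod μ).map (fun z => Function.update (fun l => V l z.1) i (V i z.2)) =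
      μ.map (fun ω l => V l ω) := by
  have h1 := (iIndepFun_iff_map_fun_eq_pi_map fun i => (hV i).aemeasurable).1 hind
  have : ∀ l, IsProbabilityMeasure (μ.map (V l)) := fun l =>
    Measure.isProbabilityMeasure_map (hV l).aemeasurable
  rw [h1]
  symm
  refine Measure.pi_eq fun s hs => ?_
  rw [Measure.map_apply (measurable_resample hV i) (MeasurableSet.univ_pi hs)]
  have hset : (fun z : Ω × Ω => Function.update (fun l => V l z.1) i (V i z.2)) ⁻¹'
      (Set.univ.pi s) = (⋂ l ∈ Finset.univ.erase i, V l ⁻¹' s l) ×ˢ (V i ⁻¹' s i) := by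
    ext z
    simp only [Set.mem_preimage, Set.mem_pi, Set.mem_univ, true_implies, Set.mem_prod,
      Set.mem_iInter, Finset.mem_erase, Finset.mem_univ, and_true]
    constructor
    · intro h
      refine ⟨fun l hl => by simpa [Function.update_of_ne hl] using h l, by simpa using h i⟩
    · rintro ⟨h, h'⟩ l
      by_cases hl : l = i
      · subst hl; simpa using h'
      · simpa [Function.update_of_ne hl] using h l hl
  rw [hset, Measure.prod_prod, hind.measure_inter_preimage_eq_mul _ fun l _ => hs l,
    ← Finset.prod_erase_mul _ _ (Finset.mem_univ i)]
  congr 1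
  · exact Finset.prod_congr rfl fun l _ => (Measure.map_apply (hV l) (hs l)).symm
  · exact (Measure.map_apply (hV i) (hs i)).symm

theorem lintegral_resample (hV : ∀ i, Measurable (V i)) (hind : iIndepFun V μ) (i : ι)
    {F : (ι → α) → ℝ≥0∞} (hF : Measurable F) :
    ∫⁻ ω, F (fun l => V l ω) ∂μ =
      ∫⁻ ω', ∫⁻ ω, F (Function.update (fun l => V l ω') i (V i ω)) ∂μ ∂μ := by
  rw [← lintegral_map (f := F) hF (measurable_pi_lambda _ hV), ← map_resample hV hind i,
    lintegral_map hF (measurable_resample hV i)]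
  exact lintegral_prod _ (hF.comp (measurable_resample hV i)).aemeasurable

/-- Here the outer variable carries coordinate `i`, so the inner integral is the conditional
expectation given that coordinate. -/
theorem lintegral_resample_swap (hV : ∀ i, Measurable (V i)) (hind : iIndepFun V μ) (i : ι)
    {F : (ι → α) → ℝ≥0∞} (hF : Measurable F) :
    ∫⁻ ω, F (fun l => V l ω) ∂μ =
      ∫⁻ ω, ∫⁻ ω', F (Function.update (fun l => V l ω') i (V i ω)) ∂μ ∂μ := by
  rw [lintegral_resample hV hind i hF]
  exact lintegral_lintegral_swap (hF.comp (measurable_resample hV i)).aemeasurable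

theorem integral_resample (hV : ∀ i, Measurable (V i)) (hind : iIndepFun V μ) (i : ι)
    {F : (ι → α) → ℝ} (hF : Measurable F) (hFi : Integrable (fun ω => F (fun l => V l ω)) μ) :
    ∫ ω, F (fun l => V l ω) ∂μ =
      ∫ ω', ∫ ω, F (Function.update (fun l => V l ω') i (V i ω)) ∂μ ∂μ := by
  have hVm : Measurable fun ω l => V l ω := measurable_pi_lambda _ hV
  have h1 : Integrable F (μ.map fun ω l => V l ω) :=
    (integrable_map_measure hF.aestronglyMeasurable hVm.aemeasurable).2 hFi
  rw [← integral_map (f := F) hVm.aemeasurable hF.aestronglyMeasurable, ← map_resample hV hind i,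
    integral_map (measurable_resample hV i).aemeasurable hF.aestronglyMeasurable]
  rw [← map_resample hV hind i] at h1
  exact integral_prod _
    ((integrable_map_measure hF.aestronglyMeasurable (measurable_resample hV i).aemeasurable).1 h1)

end Resampling

/-! ### Leave-one-out inverse neighbour counts -/

section InvRank

variable {m : ℕ}

/-- The inverse of one plus the number of the `d j`, `j ≠ i`, that are at most `t`. -/
noncomputable def invRank (t : ℝ) (d : Fin m → ℝ) (i : Fin m) : ℝ≥0∞ :=
  (1 + ∑ j ∈ Finset.univ.erase i, if d j ≤ t then 1 else 0)⁻¹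

/-- The number of the `d j` that are at most `t`. -/
noncomputable def countLE (t : ℝ) (d : Fin m → ℝ) : ℕ := (Finset.univ.filter fun j => d j ≤ t).card

theorem invRank_of_le {t : ℝ} {d : Fin m → ℝ} {i : Fin m} (hi : d i ≤ t) :
    invRank t d i = (countLE t d : ℝ≥0∞)⁻¹ := by
  unfold invRank countLE
  rw [Finset.card_filter]
  push_cast
  rw [← Finset.add_sum_erase _ _ (Finset.mem_univ i), if_pos hi]

theorem invRank_of_lt {t : ℝ} {d : Fin m → ℝ} {i : Fin m} (hi : t < d i) :
    invRank t d i = (1 + countLE t d : ℝ≥0∞)⁻¹ := by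
  unfold invRank countLE
  rw [Finset.card_filter]
  push_cast
  rw [← Finset.add_sum_erase Finset.univ _ (Finset.mem_univ i), if_neg hi.not_ge, zero_add]

/-- Every nonzero term is the inverse of the full count, and there are exactly that many of them. A
zero count is harmless, since `0 * ∞ = 0` in `ℝ≥0∞`. -/
theorem sum_invRank_le_one (t : ℝ) (d : Fin m → ℝ) :
    ∑ i, (if d i ≤ t then 1 else 0) * invRank t d i ≤ 1 := by
  calc ∑ i, (if d i ≤ t then 1 else 0) * invRank t d i
      = ∑ i, (if d i ≤ t then 1 else 0) * (countLE t d : ℝ≥0∞)⁻¹ := by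
        refine Finset.sum_congr rfl fun i _ => ?_
        split_ifs with h
        · rw [invRank_of_le h]
        · simp
    _ = (countLE t d : ℝ≥0∞) * (countLE t d : ℝ≥0∞)⁻¹ := by
        rw [← Finset.sum_mul, Finset.sum_boole]; rfl
    _ ≤ 1 := ENNReal.mul_inv_le_one _

/-- The price of decoupling from unit `i`: leaving it out changes one plus the remaining count to at
most `1 + c`, and `1 + c ≤ 2 * c` once `c ≥ 1`. -/
theorem inv_countLE_le {t : ℝ} {d : Fin m → ℝ} (hd : 0 < countLE t d) (i : Fin m) :
    (countLE t d : ℝ≥0∞)⁻¹ ≤ 2 * invRank t d i := by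
  rcases le_or_gt (d i) t with h | h
  · rw [invRank_of_le h]
    exact le_mul_of_one_le_left' (by norm_num)
  · rw [invRank_of_lt h]
    have h1 : (1 : ℝ≥0∞) ≤ countLE t d := by exact_mod_cast hd
    have h2 : (1 + countLE t d : ℝ≥0∞) ≤ 2 * countLE t d := by
      rw [two_mul]; gcongr
    calc (countLE t d : ℝ≥0∞)⁻¹ = 2 * (2 * countLE t d : ℝ≥0∞)⁻¹ := by
          rw [ENNReal.mul_inv (by simp) (by simp), ← mul_assoc,
            ENNReal.mul_inv_cancel (by simp) (by simp), one_mul]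
      _ ≤ _ := by gcongr

/-- Makes `invRank` dominate the indicator of having no neighbour, so that this event needs no
separate probability estimate. -/
theorem invRank_of_countLE_eq_zero {t : ℝ} {d : Fin m → ℝ} (hd : countLE t d = 0) (i : Fin m) :
    invRank t d i = 1 := by
  have h : t < d i := by
    by_contra! h
    have : i ∈ Finset.univ.filter fun j => d j ≤ t := by simpa using h
    rw [Finset.card_eq_zero.1 hd] at this
    simp at this
  rw [invRank_of_lt h, hd]
  simp

theorem measurable_invRank (t : ℝ) (i : Fin m) : Measurable fun d : Fin m → ℝ => invRank t d i := by
  unfold invRank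
  have h : ∀ j : Fin m, Measurable fun d : Fin m → ℝ => (if d j ≤ t then 1 else 0 : ℝ≥0∞) :=
    fun j => Measurable.ite (measurableSet_le (measurable_pi_apply j) measurable_const)
      measurable_const measurable_const
  fun_prop

theorem invRank_update (t : ℝ) (d : Fin m → ℝ) (i : Fin m) (x : ℝ) :
    invRank t (Function.update d i x) i = invRank t d i := by
  unfold invRank
  congr 2
  refine Finset.sum_congr rfl fun j hj => ?_
  rw [Function.update_of_ne (Finset.ne_of_mem_erase hj)]

attribute [irreducible] invRank

end InvRank

/-! ### Expected inverse counts and the small ball probability -/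

section Expectation

variable {Ω α : Type*} [MeasurableSpace Ω] [MeasurableSpace α] {μ : Measure Ω}
  [IsProbabilityMeasure μ] {m : ℕ} {V : Fin (m + 1) → Ω → α} {δ : α → α → ℝ} {t : ℝ}
  {π : α → ℝ≥0∞}

/-- As `invRank` at `i` does not see unit `i`, resampling that unit turns the indicator `δ (V i) q ≤
t` into its probability `π q`. The products of indicator and `invRank` then sum to at most one
pointwise. -/
theorem mul_lintegral_sum_invRank_le (hV : ∀ i, Measurable (V i)) (hind : iIndepFun V μ)
    (hδ : Measurable (Function.uncurry δ)) (q : α)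
    (hπ : ∀ i, μ {ω | δ (V i ω) q ≤ t} = π q) :
    π q * ∫⁻ ω, ∑ i, invRank t (fun j : Fin m => δ (V j.castSucc ω) q) i ∂μ ≤ 1 := by
  have hδq : Measurable fun u => δ u q := hδ.of_uncurry_right
  have hd : Measurable fun (x : Fin (m + 1) → α) (j : Fin m) => δ (x j.castSucc) q :=
    measurable_pi_lambda _ fun j => hδq.comp (measurable_pi_apply _)
  have hs : ∀ i, Measurable fun ω => invRank t (fun j : Fin m => δ (V j.castSucc ω) q) i :=
    fun i => (measurable_invRank t i).comp (hd.comp (measurable_pi_lambda _ hV))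
  have hite : Measurable fun u : α => (if δ u q ≤ t then 1 else 0 : ℝ≥0∞) :=
    Measurable.ite (measurableSet_le hδq measurable_const) measurable_const measurable_const
  have hiteV : ∀ i, Measurable fun ω => (if δ (V i ω) q ≤ t then 1 else 0 : ℝ≥0∞) :=
    fun i => hite.comp (hV i)
  have key : ∀ i : Fin m, π q * ∫⁻ ω, invRank t (fun j : Fin m => δ (V j.castSucc ω) q) i ∂μ =
      ∫⁻ ω, (if δ (V i.castSucc ω) q ≤ t then 1 else 0) *
        invRank t (fun j : Fin m => δ (V j.castSucc ω) q) i ∂μ := by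
    intro i
    rw [lintegral_resample hV hind i.castSucc
      (F := fun x => (if δ (x i.castSucc) q ≤ t then 1 else 0) *
        invRank t (fun j : Fin m => δ (x j.castSucc) q) i)
      ((hite.comp (measurable_pi_apply _)).mul ((measurable_invRank t i).comp hd)),
      ← lintegral_const_mul _ (hs i)]
    refine lintegral_congr fun ω' => ?_
    have hu : ∀ ω, invRank t (fun j : Fin m =>
        δ (Function.update (fun l => V l ω') i.castSucc (V i.castSucc ω) j.castSucc) q) i =
        invRank t (fun j : Fin m => δ (V j.castSucc ω') q) i := by
      intro ω
      rw [← invRank_update t (fun j : Fin m => δ (V j.castSucc ω') q) i (δ (V i.castSucc ω) q)]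
      congr 1
      funext j
      by_cases h : j = i
      · subst h; simp
      · rw [Function.update_of_ne (by simpa using h), Function.update_of_ne h]
    simp only [hu, Function.update_self]
    rw [lintegral_mul_const _ (hiteV _), ← hπ i.castSucc]
    congr 1
    have hset : MeasurableSet {ω | δ (V i.castSucc ω) q ≤ t} :=
      measurableSet_le (hδq.comp (hV _)) measurable_const
    rw [← lintegral_indicator_one hset]
    rfl
  rw [lintegral_finsetSum _ fun i _ => hs i, Finset.mul_sum, Finset.sum_congr rfl fun i _ => key i,
    ← lintegral_finsetSum _ fun i _ => (hiteV _).fun_mul (hs i)]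
  calc _ ≤ ∫⁻ _, 1 ∂μ := lintegral_mono fun ω => sum_invRank_le_one _ _
    _ = 1 := by simp

theorem measurable_invRank_sample (hδ : Measurable (Function.uncurry δ)) (i : Fin m) :
    Measurable fun x : Fin (m + 1) → α =>
      invRank t (fun j : Fin m => δ (x j.castSucc) (x (Fin.last m))) i := by
  refine (measurable_invRank t i).comp (measurable_pi_lambda _ fun j => ?_)
  have h : Measurable fun x : Fin (m + 1) → α => (x j.castSucc, x (Fin.last m)) := by fun_prop
  exact hδ.comp h

/-- Condition on the new unit and apply the bound for a fixed centre. The factor `φ` is there to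
carry the density error of the new unit, which is not independent of the distances. -/
theorem lintegral_last_mul_sum_invRank_le (hV : ∀ i, Measurable (V i)) (hind : iIndepFun V μ)
    (hδ : Measurable (Function.uncurry δ))
    (hπ : ∀ i q, μ {ω | δ (V i ω) q ≤ t} = π q) {φ : α → ℝ≥0∞} (hφ : Measurable φ) :
    ∫⁻ ω, φ (V (Fin.last m) ω) *
        ∑ i, invRank t (fun j : Fin m => δ (V j.castSucc ω) (V (Fin.last m) ω)) i ∂μ ≤
      ∫⁻ ω, φ (V (Fin.last m) ω) * (π (V (Fin.last m) ω))⁻¹ ∂μ := by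
  have hs := fun i => measurable_invRank_sample (t := t) (m := m) hδ i
  have hφl : Measurable fun x : Fin (m + 1) → α => φ (x (Fin.last m)) :=
    hφ.comp (measurable_pi_apply _)
  rw [lintegral_resample_swap hV hind (Fin.last m) (F := fun x => φ (x (Fin.last m)) *
      ∑ i, invRank t (fun j : Fin m => δ (x j.castSucc) (x (Fin.last m))) i) (by fun_prop)]
  refine lintegral_mono fun ω => ?_
  simp only [Function.update_self, Function.update_of_ne (Fin.castSucc_lt_last _).ne]
  rw [lintegral_const_mul]
  · gcongr
    rw [ENNReal.le_inv_iff_mul_le, mul_comm]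
    exact mul_lintegral_sum_invRank_le hV hind hδ _ fun i => hπ i _
  · exact Finset.measurable_fun_sum _ fun i _ => (measurable_invRank t i).comp
      (measurable_pi_lambda _ fun j => hδ.of_uncurry_right.comp (hV _))

/-- The reason for leaving one out: the density error of training unit `i` depends on that unit
alone, hence factors out of the expectation. -/
theorem lintegral_castSucc_mul_invRank (hV : ∀ i, Measurable (V i)) (hind : iIndepFun V μ)
    (hδ : Measurable (Function.uncurry δ)) {φ : α → ℝ≥0∞} (hφ : Measurable φ) (i : Fin m) :
    ∫⁻ ω, φ (V i.castSucc ω) *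
        invRank t (fun j : Fin m => δ (V j.castSucc ω) (V (Fin.last m) ω)) i ∂μ =
      (∫⁻ ω, φ (V i.castSucc ω) ∂μ) *
        ∫⁻ ω, invRank t (fun j : Fin m => δ (V j.castSucc ω) (V (Fin.last m) ω)) i ∂μ := by
  have hs := measurable_invRank_sample (t := t) (m := m) hδ i
  have hφi : Measurable fun x : Fin (m + 1) → α => φ (x i.castSucc) := by
    fun_prop
  have hsV : Measurable fun ω =>
      invRank t (fun j : Fin m => δ (V j.castSucc ω) (V (Fin.last m) ω)) i := by
    have hVm : Measurable fun ω l => V l ω := measurable_pi_lambda _ hV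
    exact hs.comp hVm
  have hφV : Measurable fun ω => φ (V i.castSucc ω) := hφ.comp (hV _)
  have key : ∀ ω' ω, (fun x : Fin (m + 1) → α => φ (x i.castSucc) *
      invRank t (fun j : Fin m => δ (x j.castSucc) (x (Fin.last m))) i)
        (Function.update (fun l => V l ω') i.castSucc (V i.castSucc ω)) =
      φ (V i.castSucc ω) *
        invRank t (fun j : Fin m => δ (V j.castSucc ω') (V (Fin.last m) ω')) i := by
    intro ω' ω
    have h1 : (fun j : Fin m => δ (Function.update (fun l => V l ω') i.castSucc
        (V i.castSucc ω) j.castSucc) (V (Fin.last m) ω')) =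
        Function.update (fun j : Fin m => δ (V j.castSucc ω') (V (Fin.last m) ω')) i
          (δ (V i.castSucc ω) (V (Fin.last m) ω')) := by
      funext j
      by_cases h : j = i
      · subst h; simp
      · rw [Function.update_of_ne (by simpa using h), Function.update_of_ne h]
    beta_reduce
    rw [Function.update_self, Function.update_of_ne (Fin.castSucc_lt_last _).ne', h1,
      invRank_update]
  refine (lintegral_resample hV hind i.castSucc (F := fun x => φ (x i.castSucc) *
      invRank t (fun j : Fin m => δ (x j.castSucc) (x (Fin.last m))) i) (by fun_prop)).trans ?_
  simp only [key]
  rw [← lintegral_const_mul _ hsV]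
  exact lintegral_congr fun ω' => lintegral_mul_const _ hφV

end Expectation

/-! ### Orthogonality of the noise -/

section Noise

variable {Ω ι τ α γ : Type*} [DecidableEq ι] [Fintype ι] [Fintype τ] [MeasurableSpace Ω]
  [MeasurableSpace α] [MeasurableSpace γ] {μ : Measure Ω} [IsProbabilityMeasure μ]
  {V : ι → Ω → α} {ξ : α → ℝ} {p : α → γ} {M : ℝ}

/-- A family with conditional mean zero given a σ-algebra `σ(p)` integrates to zero against bounded
functions of `p`. -/
theorem integral_mul_comp_eq_zero {Z : Ω → ℝ} {p : Ω → γ} (hZ : Integrable Z μ)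
    (hp : Measurable p) (h0 : μ[Z | MeasurableSpace.comap p inferInstance] =ᵐ[μ] 0)
    {G : γ → ℝ} (hG : Measurable G) {C : ℝ} (hC : ∀ x, |G x| ≤ C) :
    ∫ ω, Z ω * G (p ω) ∂μ = 0 := by
  have hGm : StronglyMeasurable[MeasurableSpace.comap p inferInstance] fun ω => G (p ω) :=
    (hG.comp (comap_measurable p)).stronglyMeasurable
  have hint : Integrable (Z * fun ω => G (p ω)) μ :=
    hZ.mul_bdd (c := C) (hG.comp hp).aestronglyMeasurable (ae_of_all _ fun ω => hC _)
  have h1 := condExp_mul_of_stronglyMeasurable_right hGm hint hZ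
  have h2 : ∫ ω, Z ω * G (p ω) ∂μ = ∫ ω, (Z * fun ω => G (p ω)) ω ∂μ := rfl
  rw [h2, ← integral_condExp hp.comap_le, integral_congr_ae h1]
  refine integral_eq_zero_of_ae ?_
  filter_upwards [h0] with ω hω
  simp [hω]

omit [Fintype ι] [DecidableEq ι] in
theorem integrable_noise_mul (hV : ∀ i, Measurable (V i)) (hξ : Measurable ξ)
    (hM : ∀ i, ∀ᵐ ω ∂μ, |ξ (V i ω)| ≤ M) {g : Ω → ℝ} (hg : Measurable g) (hg1 : ∀ x, |g x| ≤ 1)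
    (i j : ι) : Integrable (fun ω => ξ (V i ω) * ξ (V j ω) * g ω) μ := by
  have hm : Measurable fun ω => ξ (V i ω) * ξ (V j ω) * g ω :=
    ((hξ.comp (hV i)).mul (hξ.comp (hV j))).mul hg
  refine Integrable.of_bound hm.aestronglyMeasurable (M * M * 1) ?_
  filter_upwards [hM i, hM j] with ω h1 h2
  rw [Real.norm_eq_abs, abs_mul, abs_mul]
  have := (abs_nonneg _).trans h1
  exact mul_le_mul (mul_le_mul h1 h2 (abs_nonneg _) this) (hg1 _) (abs_nonneg _) (by positivity)

/-- Freeze all units except `i`. What remains is the noise of unit `i` against a bounded function of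
its conditioning variable, which integrates to zero by `h0`. -/
theorem integral_noise_mul_noise_eq_zero (hV : ∀ i, Measurable (V i)) (hind : iIndepFun V μ)
    (hξ : Measurable ξ) (hp : Measurable p) (hM : ∀ i, ∀ᵐ ω ∂μ, |ξ (V i ω)| ≤ M)
    (h0 : ∀ i, ∀ G : γ → ℝ, Measurable G → (∀ x, |G x| ≤ 1) →
      ∫ ω, ξ (V i ω) * G (p (V i ω)) ∂μ = 0)
    {g : (ι → γ) → ℝ} (hg : Measurable g) (hg1 : ∀ x, |g x| ≤ 1) {i j : ι} (hij : i ≠ j) :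
    ∫ ω, ξ (V i ω) * ξ (V j ω) * g (fun l => p (V l ω)) ∂μ = 0 := by
  have hpm : Measurable fun (x : ι → α) l => p (x l) := by fun_prop
  have hgm : Measurable fun x : ι → α => g (fun l => p (x l)) := hg.comp hpm
  have hF : Measurable fun x : ι → α => ξ (x i) * ξ (x j) * g (fun l => p (x l)) :=
    ((hξ.comp (measurable_pi_apply i)).mul (hξ.comp (measurable_pi_apply j))).mul hgm
  have hVm : Measurable fun ω l => V l ω := measurable_pi_lambda _ hV
  refine (integral_resample hV hind i hF
    (integrable_noise_mul hV hξ hM (hgm.comp hVm) (fun ω => hg1 _) i j)).trans ?_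
  refine integral_eq_zero_of_ae (ae_of_all _ fun ω' => ?_)
  simp only [Function.update_self, Function.update_of_ne hij.symm, Pi.zero_apply]
  have key : ∀ ω, ξ (V i ω) * ξ (V j ω') *
      g (fun l => p (Function.update (fun l => V l ω') i (V i ω) l)) =
      ξ (V j ω') * (ξ (V i ω) * g (Function.update (fun l => p (V l ω')) i (p (V i ω)))) := by
    intro ω
    have : (fun l => p (Function.update (fun l => V l ω') i (V i ω) l)) =
        Function.update (fun l => p (V l ω')) i (p (V i ω)) := by
      funext l
      by_cases h : l = i
      · subst h; simp
      · simp [Function.update_of_ne h]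
    rw [this]; ring
  simp only [key]
  rw [integral_const_mul, h0 i (fun c => g (Function.update (fun l => p (V l ω')) i c))
    (hg.comp (measurable_update _)) (fun c => hg1 _), mul_zero]

theorem lintegral_abs_le_sqrt {Z : Ω → ℝ} (hZ : Measurable Z) :
    ∫⁻ ω, ENNReal.ofReal |Z ω| ∂μ ≤ (∫⁻ ω, ENNReal.ofReal (Z ω ^ 2) ∂μ) ^ (1 / 2 : ℝ) := by
  have h := ENNReal.lintegral_mul_le_Lp_mul_Lq μ Real.HolderConjugate.two_two
    (f := fun ω => ENNReal.ofReal |Z ω|) (g := fun _ => 1) (by fun_prop) (by fun_prop)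
  simp only [Pi.mul_apply, mul_one, ENNReal.one_rpow, lintegral_const, measure_univ] at h
  refine h.trans_eq ?_
  congr 2
  funext ω
  rw [ENNReal.rpow_two, ← ENNReal.ofReal_pow (abs_nonneg _), sq_abs]

/-- Weighted sums of the noise variables are orthogonal sums when the weights depend only on the
conditioning variables. -/
theorem lintegral_abs_sum_noise_le (hV : ∀ i, Measurable (V i)) (hind : iIndepFun V μ)
    (hξ : Measurable ξ) (hp : Measurable p) (hM0 : 0 ≤ M) (hM : ∀ i, ∀ᵐ ω ∂μ, |ξ (V i ω)| ≤ M)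
    (h0 : ∀ i, ∀ G : γ → ℝ, Measurable G → (∀ x, |G x| ≤ 1) →
      ∫ ω, ξ (V i ω) * G (p (V i ω)) ∂μ = 0)
    (e : τ ↪ ι) {w : τ → (ι → γ) → ℝ} (hw : ∀ a, Measurable (w a)) (hw1 : ∀ a x, |w a x| ≤ 1) :
    ∫⁻ ω, ENNReal.ofReal |∑ a, ξ (V (e a) ω) * w a (fun l => p (V l ω))| ∂μ ≤
      ENNReal.ofReal M *
        (∫⁻ ω, ENNReal.ofReal (∑ a, w a (fun l => p (V l ω)) ^ 2) ∂μ) ^ (1 / 2 : ℝ) := by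
  have hpm : Measurable fun ω l => p (V l ω) :=
    measurable_pi_lambda _ fun l => hp.comp (hV l)
  have hwm : ∀ a, Measurable fun ω => w a (fun l => p (V l ω)) := fun a => (hw a).comp hpm
  have hξm : ∀ i, Measurable fun ω => ξ (V i ω) := fun i => hξ.comp (hV i)
  have hint : ∀ a b, Integrable (fun ω => ξ (V (e a) ω) * ξ (V (e b) ω) *
      (w a (fun l => p (V l ω)) * w b (fun l => p (V l ω)))) μ := fun a b =>
    integrable_noise_mul hV hξ hM ((hwm a).mul (hwm b)) (fun ω => by
      rw [Pi.mul_apply, abs_mul]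
      exact mul_le_one₀ (hw1 _ _) (abs_nonneg _) (hw1 _ _)) _ _
  have hsq : ∀ ω, (∑ a, ξ (V (e a) ω) * w a (fun l => p (V l ω))) ^ 2 =
      ∑ a, ∑ b, ξ (V (e a) ω) * ξ (V (e b) ω) *
        (w a (fun l => p (V l ω)) * w b (fun l => p (V l ω))) := by
    intro ω
    rw [sq, Finset.sum_mul_sum]
    exact Finset.sum_congr rfl fun a _ => Finset.sum_congr rfl fun b _ => by ring
  have hintw : ∀ a, Integrable (fun ω => w a (fun l => p (V l ω)) ^ 2) μ := fun a =>
    Integrable.of_bound ((hwm a).pow_const 2).aestronglyMeasurable 1 (ae_of_all _ fun ω => by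
      rw [Real.norm_eq_abs, abs_pow]; exact pow_le_one₀ (abs_nonneg _) (hw1 _ _))
  -- Only the diagonal of the double sum survives, and there the squared noise is at most `M ^ 2`.
  have hdiag : ∫ ω, (∑ a, ξ (V (e a) ω) * w a (fun l => p (V l ω))) ^ 2 ∂μ ≤
      M ^ 2 * ∫ ω, ∑ a, w a (fun l => p (V l ω)) ^ 2 ∂μ := by
    simp only [hsq]
    rw [integral_finsetSum _ fun a _ => integrable_finsetSum _ fun b _ => hint a b,
      integral_finsetSum _ fun a _ => hintw a, Finset.mul_sum]
    refine Finset.sum_le_sum fun a _ => ?_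
    rw [integral_finsetSum _ fun b _ => hint a b, Finset.sum_eq_single a]
    · rw [← integral_const_mul]
      refine integral_mono_ae (hint a a) ((hintw a).const_mul _) ?_
      filter_upwards [hM (e a)] with ω hω
      have h1 : ξ (V (e a) ω) ^ 2 ≤ M ^ 2 := sq_le_sq' (neg_le_of_abs_le hω) (le_of_abs_le hω)
      calc _ = ξ (V (e a) ω) ^ 2 * w a (fun l => p (V l ω)) ^ 2 := by ring
        _ ≤ _ := by gcongr
    · intro b _ hb
      exact integral_noise_mul_noise_eq_zero hV hind hξ hp hM h0
        (g := fun x => w a x * w b x) ((hw a).mul (hw b))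
        (fun x => by rw [abs_mul]; exact mul_le_one₀ (hw1 _ _) (abs_nonneg _) (hw1 _ _))
        (e.injective.ne hb.symm)
    · simp
  have hZm : Measurable fun ω => ∑ a, ξ (V (e a) ω) * w a (fun l => p (V l ω)) := by fun_prop
  refine (lintegral_abs_le_sqrt hZm).trans ?_
  have hM' : ENNReal.ofReal M = (ENNReal.ofReal (M ^ 2)) ^ (1 / 2 : ℝ) := by
    rw [ENNReal.ofReal_rpow_of_nonneg (by positivity) (by norm_num), ← Real.sqrt_eq_rpow,
      Real.sqrt_sq hM0]
  rw [hM', ← ENNReal.mul_rpow_of_nonneg _ _ (by norm_num)]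
  refine ENNReal.rpow_le_rpow ?_ (by norm_num)
  rw [← ofReal_integral_eq_lintegral_ofReal, ← ofReal_integral_eq_lintegral_ofReal,
    ← ENNReal.ofReal_mul (by positivity)]
  · exact ENNReal.ofReal_le_ofReal hdiag
  · exact integrable_finsetSum _ fun a _ => hintw a
  · exact ae_of_all _ fun ω => Finset.sum_nonneg fun a _ => sq_nonneg _
  · simp only [hsq]
    exact integrable_finsetSum _ fun a _ => integrable_finsetSum _ fun b _ => hint a b
  · exact ae_of_all _ fun ω => sq_nonneg _

end Noise

/-! ### Deterministic error analysis of kernel regression -/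

section Deterministic

variable {m : ℕ} {K : ℝ → ℝ} {LK : ℝ≥0} {κ r R : ℝ}

/-- The box bounds are given for positive arguments only, while a distance may be zero; continuity
of `K` at `0` from the right fills the gap. -/
theorem IsBoxedKernel.le_apply (hK : IsBoxedKernel K LK κ r R) (hr : 0 < r) {x : ℝ} (hx : 0 ≤ x)
    (hxr : x ≤ r) : κ ≤ K x := by
  have hpos : ∀ y, 0 < y → y ≤ r → κ ≤ K y := fun y hy hyr => by
    have := hK.lower y hy
    rwa [Set.indicator_of_mem (by simp [abs_of_pos hy, hyr]), Pi.one_apply, mul_one] at this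
  rcases hx.eq_or_lt with rfl | hx
  · have hc : Filter.Tendsto K (nhdsWithin 0 (Set.Ioi 0)) (nhds (K 0)) :=
      (hK.lipschitz.continuousOn 0 Set.self_mem_Ici).mono_left
        (nhdsWithin_mono _ Set.Ioi_subset_Ici_self)
    refine ge_of_tendsto hc ?_
    filter_upwards [Ioc_mem_nhdsGT hr] with y hy using hpos y hy.1 hy.2
  · exact hpos x hx hxr

theorem IsBoxedKernel.apply_le_one (hK : IsBoxedKernel K LK κ r R) {x : ℝ} (hx : 0 ≤ x) :
    K x ≤ 1 := by
  have hpos : ∀ y, 0 < y → K y ≤ 1 := fun y hy =>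
    (hK.upper y hy).trans (Set.indicator_le_self' (by simp) y)
  rcases hx.eq_or_lt with rfl | hx
  · have hc : Filter.Tendsto K (nhdsWithin 0 (Set.Ioi 0)) (nhds (K 0)) :=
      (hK.lipschitz.continuousOn 0 Set.self_mem_Ici).mono_left
        (nhdsWithin_mono _ Set.Ioi_subset_Ici_self)
    refine le_of_tendsto hc ?_
    filter_upwards [self_mem_nhdsWithin] with y hy using hpos y hy
  · exact hpos x hx

theorem IsBoxedKernel.eq_zero (hK : IsBoxedKernel K LK κ r R) (hR : 0 ≤ R) {x : ℝ} (hx : R < x) :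
    K x = 0 := by
  have h0 : 0 < x := hR.trans_lt hx
  have := hK.upper x h0
  rw [Set.indicator_of_notMem (by simp [abs_of_pos h0, hx])] at this
  exact this.antisymm (hK.nonneg x h0.le)

theorem abs_kernelRegression_le {h M : ℝ} (hM : 0 ≤ M) {d y : Fin m → ℝ}
    (hK0 : ∀ i, 0 ≤ K (d i / h)) (hy : ∀ i, |y i| ≤ M) : |kernelRegression K h d y| ≤ M := by
  unfold kernelRegression
  split_ifs with hs
  · rw [abs_div, abs_of_pos hs, div_le_iff₀ hs, Finset.mul_sum]
    refine (Finset.abs_sum_le_sum_abs _ _).trans (Finset.sum_le_sum fun i _ => ?_)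
    rw [abs_mul, abs_of_nonneg (hK0 i)]
    exact mul_le_mul_of_nonneg_right (hy i) (hK0 i)
  · simpa using hM

/-- Stability of the kernel regression estimate in the distances. -/
theorem abs_kernelRegression_sub_le {h M : ℝ} (hM : 0 ≤ M) {d d' y : Fin m → ℝ}
    (hK0' : ∀ i, 0 ≤ K (d' i / h)) (hy : ∀ i, |y i| ≤ M)
    (hs : 0 < ∑ i, K (d i / h)) :
    |kernelRegression K h d' y - kernelRegression K h d y| ≤
      2 * M * (∑ i, |K (d' i / h) - K (d i / h)|) / ∑ i, K (d i / h) := by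
  set f' := kernelRegression K h d' y with hf'
  have hf'M : |f'| ≤ M := abs_kernelRegression_le hM hK0' hy
  -- Holds for the default value too: if the total weight is zero, every weight is zero.
  have hfac : f' * ∑ i, K (d' i / h) = ∑ i, y i * K (d' i / h) := by
    rw [hf', kernelRegression]
    split_ifs with hs'
    · exact div_mul_cancel₀ _ hs'.ne'
    · have h0 : ∑ i, K (d' i / h) = 0 :=
        (not_lt.1 hs').antisymm (Finset.sum_nonneg fun i _ => hK0' i)
      have h1 := (Finset.sum_eq_zero_iff_of_nonneg fun i _ => hK0' i).1 h0
      rw [zero_mul]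
      exact (Finset.sum_eq_zero fun i hi => by rw [h1 i hi, mul_zero]).symm
  -- Centring at `f'` makes the terms with `K (d' i / h)` cancel by `hfac`. Thus only the oracle
  -- weights appear in the denominator, and no lower bound for the estimated ones is needed.
  have hid : f' - kernelRegression K h d y =
      (∑ i, (y i - f') * (K (d' i / h) - K (d i / h))) / ∑ i, K (d i / h) := by
    rw [kernelRegression, if_pos hs, eq_div_iff hs.ne', sub_mul, div_mul_cancel₀ _ hs.ne']
    have : ∑ i, (y i - f') * (K (d' i / h) - K (d i / h)) =
        ((∑ i, y i * K (d' i / h)) - f' * ∑ i, K (d' i / h)) -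
          ((∑ i, y i * K (d i / h)) - f' * ∑ i, K (d i / h)) := by
      simp only [Finset.mul_sum, ← Finset.sum_sub_distrib]
      exact Finset.sum_congr rfl fun i _ => by ring
    rw [this, hfac]; ring
  rw [hid, abs_div, abs_of_pos hs]
  gcongr
  rw [Finset.mul_sum]
  refine (Finset.abs_sum_le_sum_abs _ _).trans (Finset.sum_le_sum fun i _ => ?_)
  rw [abs_mul]
  gcongr
  calc |y i - f'| ≤ |y i| + |f'| := abs_sub _ _
    _ ≤ 2 * M := by linarith [hy i]

theorem mul_countLE_le_sum (hK : IsBoxedKernel K LK κ r R) (hr : 0 < r)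
    {h : ℝ} (hh : 0 < h) {d : Fin m → ℝ} (hd : ∀ i, 0 ≤ d i) :
    κ * countLE (r * h) d ≤ ∑ i, K (d i / h) := by
  rw [countLE, Finset.card_filter]
  push_cast
  rw [Finset.mul_sum]
  refine Finset.sum_le_sum fun i _ => ?_
  split_ifs with hi
  · rw [mul_one]
    exact hK.le_apply hr (div_nonneg (hd i) hh.le) ((div_le_iff₀ hh).2 hi)
  · rw [mul_zero]
    exact hK.nonneg _ (div_nonneg (hd i) hh.le)

/-- The normalized weights of the kernel regression, set to zero when no distance is at most
`t`. -/
noncomputable def regWeight (K : ℝ → ℝ) (h t : ℝ) (d : Fin m → ℝ) (i : Fin m) : ℝ :=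
  if 0 < countLE t d then K (d i / h) / ∑ j, K (d j / h) else 0

theorem regWeight_nonneg {h t : ℝ} {d : Fin m → ℝ} (hK0 : ∀ i, 0 ≤ K (d i / h)) (i : Fin m) :
    0 ≤ regWeight K h t d i := by
  unfold regWeight
  split_ifs
  · exact div_nonneg (hK0 i) (Finset.sum_nonneg fun j _ => hK0 j)
  · exact le_rfl

theorem regWeight_le_one {h t : ℝ} {d : Fin m → ℝ} (hK0 : ∀ i, 0 ≤ K (d i / h)) (i : Fin m) :
    regWeight K h t d i ≤ 1 := by
  unfold regWeight
  split_ifs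
  · exact div_le_one_of_le₀ (Finset.single_le_sum (fun j _ => hK0 j) (Finset.mem_univ i))
      (Finset.sum_nonneg fun j _ => hK0 j)
  · exact zero_le_one

/-- Since `K ≤ 1`, the squares satisfy `K ^ 2 ≤ K`, so the sum is at most the inverse total weight,
hence at most `1 / (κ * c)`. The index `i` is free and is later chosen to make the expectation
small. -/
theorem sum_regWeight_sq_le (hK : IsBoxedKernel K LK κ r R) (hκ : 0 < κ) (hr : 0 < r)
    {h : ℝ} (hh : 0 < h) {d : Fin m → ℝ} (hd : ∀ i, 0 ≤ d i) (i : Fin m) :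
    ENNReal.ofReal (∑ j, regWeight K h (r * h) d j ^ 2) ≤
      ENNReal.ofReal (2 / κ) * invRank (r * h) d i := by
  have hd' : ∀ i, 0 ≤ d i / h := fun i => div_nonneg (hd i) hh.le
  by_cases hN : 0 < countLE (r * h) d
  · have hNR : (0 : ℝ) < countLE (r * h) d := by exact_mod_cast hN
    have hS := mul_countLE_le_sum hK hr hh hd
    have hS0 : 0 < ∑ j, K (d j / h) := (mul_pos hκ hNR).trans_le hS
    have h1 : ∑ j, regWeight K h (r * h) d j ^ 2 ≤ κ⁻¹ * (countLE (r * h) d : ℝ)⁻¹ := by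
      calc ∑ j, regWeight K h (r * h) d j ^ 2
          = ∑ j, K (d j / h) ^ 2 / (∑ j, K (d j / h)) ^ 2 := by
            simp only [regWeight, if_pos hN, div_pow]
        _ ≤ ∑ j, K (d j / h) / (∑ j, K (d j / h)) ^ 2 := by
            gcongr with j
            have := hK.apply_le_one (hd' j)
            have := hK.nonneg _ (hd' j)
            nlinarith
        _ = (∑ j, K (d j / h))⁻¹ := by
            rw [← Finset.sum_div]; field_simp
        _ ≤ (κ * countLE (r * h) d)⁻¹ := by gcongr
        _ = _ := mul_inv _ _
    calc _ ≤ ENNReal.ofReal (κ⁻¹ * (countLE (r * h) d : ℝ)⁻¹) := ENNReal.ofReal_le_ofReal h1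
      _ = ENNReal.ofReal κ⁻¹ * (countLE (r * h) d : ℝ≥0∞)⁻¹ := by
          rw [ENNReal.ofReal_mul (by positivity), ENNReal.ofReal_inv_of_pos hNR,
            ENNReal.ofReal_natCast]
      _ ≤ ENNReal.ofReal κ⁻¹ * (2 * invRank (r * h) d i) := by
          gcongr; exact inv_countLE_le hN i
      _ = _ := by
          rw [div_eq_mul_inv, ENNReal.ofReal_mul (by norm_num)]
          simp only [ENNReal.ofReal_ofNat]
          ring
  · simp [regWeight, if_neg hN]

/-- Error decomposition of the kernel regression estimate. -/
theorem ofReal_abs_kernelRegression_sub_le (hK : IsBoxedKernel K LK κ r R) (hκ : 0 < κ)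
    (hr : 0 < r) (hR : 0 ≤ R) {h M F L β : ℝ} (hh : 0 < h) (hM : 0 ≤ M) (hL : 0 ≤ L) (hβ : 0 ≤ β)
    {d d' e y v : Fin m → ℝ} {e₀ v₀ : ℝ} (hd : ∀ i, 0 ≤ d i) (hd' : ∀ i, 0 ≤ d' i)
    (hdd : ∀ i, |d' i - d i| ≤ e i + e₀) (he : ∀ i, 0 ≤ e i) (he₀ : 0 ≤ e₀)
    (hy : ∀ i, |y i| ≤ M) (hv₀ : |v₀| ≤ F) (hv : ∀ i, |v i - v₀| ≤ L * d i ^ β) (i₀ : Fin m) :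
    ENNReal.ofReal |kernelRegression K h d' y - v₀| ≤
      ENNReal.ofReal (4 * M * LK / (κ * h)) *
          ((∑ i, ENNReal.ofReal (e i) * invRank (r * h) d i) +
            ENNReal.ofReal e₀ * ∑ i, invRank (r * h) d i) +
        ENNReal.ofReal (L * R ^ β * h ^ β) +
        ENNReal.ofReal |∑ i, (y i - v i) * regWeight K h (r * h) d i| +
        ENNReal.ofReal (M + F) * invRank (r * h) d i₀ := by
  have hdh : ∀ i, 0 ≤ d i / h := fun i => div_nonneg (hd i) hh.le
  have hdh' : ∀ i, 0 ≤ d' i / h := fun i => div_nonneg (hd' i) hh.le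
  have hK0 := fun i => hK.nonneg _ (hdh i)
  have hK0' := fun i => hK.nonneg _ (hdh' i)
  have hF : 0 ≤ F := (abs_nonneg _).trans hv₀
  -- Without neighbours the last summand alone suffices, as `invRank` equals one there.
  by_cases hN : 0 < countLE (r * h) d
  swap
  · rw [invRank_of_countLE_eq_zero (by omega), mul_one]
    refine le_add_of_nonneg_of_le zero_le (ENNReal.ofReal_le_ofReal ?_)
    exact (abs_sub _ _).trans (add_le_add (abs_kernelRegression_le hM hK0' hy) hv₀)
  refine le_add_of_le_of_nonneg ?_ zero_le
  have hNR : (0 : ℝ) < countLE (r * h) d := by exact_mod_cast hN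
  have hS := mul_countLE_le_sum hK hr hh hd
  set S := ∑ j, K (d j / h) with hSdef
  have hS0 : 0 < S := (mul_pos hκ hNR).trans_le hS
  have hreg : kernelRegression K h d y - v₀ =
      (∑ i, (y i - v i) * regWeight K h (r * h) d i) + (∑ i, (v i - v₀) * K (d i / h)) / S := by
    simp only [kernelRegression, regWeight, if_pos hN, if_pos hS0, ← hSdef]
    rw [Finset.sum_div, Finset.sum_div, ← Finset.sum_add_distrib]
    have : v₀ = ∑ i, v₀ * (K (d i / h) / S) := by
      rw [← Finset.mul_sum, ← Finset.sum_div, ← hSdef, div_self hS0.ne', mul_one]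
    conv_lhs => rw [this]
    rw [← Finset.sum_sub_distrib]
    exact Finset.sum_congr rfl fun i _ => by ring
  have hbias : |(∑ i, (v i - v₀) * K (d i / h)) / S| ≤ L * R ^ β * h ^ β := by
    rw [abs_div, abs_of_pos hS0, div_le_iff₀ hS0, hSdef, Finset.mul_sum]
    refine (Finset.abs_sum_le_sum_abs _ _).trans (Finset.sum_le_sum fun i _ => ?_)
    rw [abs_mul, abs_of_nonneg (hK0 i)]
    rcases lt_or_ge R (d i / h) with hi | hi
    · rw [hK.eq_zero hR hi]; simp
    · refine mul_le_mul_of_nonneg_right ((hv i).trans ?_) (hK0 i)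
      rw [mul_assoc, ← Real.mul_rpow hR hh.le]
      gcongr
      · exact hd i
      · exact (div_le_iff₀ hh).1 hi
  have hstab : |kernelRegression K h d' y - kernelRegression K h d y| ≤
      2 * M * LK / (κ * h) * ((∑ i, (e i + e₀)) * (countLE (r * h) d : ℝ)⁻¹) := by
    refine (abs_kernelRegression_sub_le hM hK0' hy hS0).trans ?_
    have h1 : ∀ i, |K (d' i / h) - K (d i / h)| ≤ LK / h * (e i + e₀) := fun i => by
      have := hK.lipschitz.dist_le_mul _ (hdh' i) _ (hdh i)
      rw [Real.dist_eq, Real.dist_eq, ← sub_div, abs_div, abs_of_pos hh] at this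
      refine this.trans ?_
      rw [← mul_div_assoc, div_mul_eq_mul_div]
      gcongr
      exact hdd i
    calc 2 * M * (∑ i, |K (d' i / h) - K (d i / h)|) / S
        ≤ 2 * M * (∑ i, LK / h * (e i + e₀)) / (κ * countLE (r * h) d) := by
          have : 0 ≤ ∑ i, LK / h * (e i + e₀) :=
            Finset.sum_nonneg fun i _ => (abs_nonneg _).trans (h1 i)
          gcongr with i
          exact h1 i
      _ = _ := by
          rw [← Finset.mul_sum]; field_simp
  -- The common factor `1 / c` is replaced in the `i`-th summand by the inverse count leaving out
  -- that same `i`; this doubles the constant `2 * M` to `4 * M`.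
  have hE : ENNReal.ofReal ((∑ i, (e i + e₀)) * (countLE (r * h) d : ℝ)⁻¹) ≤
      2 * ((∑ i, ENNReal.ofReal (e i) * invRank (r * h) d i) +
            ENNReal.ofReal e₀ * ∑ i, invRank (r * h) d i) := by
    rw [ENNReal.ofReal_mul (Finset.sum_nonneg fun i _ => add_nonneg (he i) he₀),
      ENNReal.ofReal_inv_of_pos hNR, ENNReal.ofReal_natCast,
      ENNReal.ofReal_sum_of_nonneg fun i _ => add_nonneg (he i) he₀, Finset.sum_mul,
      Finset.mul_sum, ← Finset.sum_add_distrib, Finset.mul_sum]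
    refine Finset.sum_le_sum fun i _ => ?_
    rw [ENNReal.ofReal_add (he i) he₀, ← add_mul, mul_left_comm]
    gcongr
    exact inv_countLE_le hN i
  calc ENNReal.ofReal |kernelRegression K h d' y - v₀|
      ≤ ENNReal.ofReal (2 * M * LK / (κ * h) * ((∑ i, (e i + e₀)) * (countLE (r * h) d : ℝ)⁻¹) +
          L * R ^ β * h ^ β + |∑ i, (y i - v i) * regWeight K h (r * h) d i|) := by
        refine ENNReal.ofReal_le_ofReal ?_
        have h2 : kernelRegression K h d' y - v₀ =
          (kernelRegression K h d' y - kernelRegression K h d y) +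
            ((∑ i, (v i - v₀) * K (d i / h)) / S) +
            (∑ i, (y i - v i) * regWeight K h (r * h) d i) := by
          linear_combination hreg
        rw [h2]
        exact (abs_add_three _ _ _).trans (by gcongr)
    _ ≤ ENNReal.ofReal (2 * M * LK / (κ * h) *
          ((∑ i, (e i + e₀)) * (countLE (r * h) d : ℝ)⁻¹)) +
          ENNReal.ofReal (L * R ^ β * h ^ β) +
          ENNReal.ofReal |∑ i, (y i - v i) * regWeight K h (r * h) d i| :=
        ENNReal.ofReal_add_le.trans (by gcongr; exact ENNReal.ofReal_add_le)
    _ ≤ _ := by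
        gcongr
        rw [ENNReal.ofReal_mul (by positivity)]
        refine (mul_le_mul_right hE _).trans_eq ?_
        rw [← mul_assoc, show 4 * M * LK / (κ * h) = 2 * M * LK / (κ * h) * 2 by ring,
          ENNReal.ofReal_mul (by positivity) (q := 2), ENNReal.ofReal_ofNat]

end Deterministic

/-! ### Jointly measurable densities and measurability of L₁ distances -/

section Density

variable {k : ℕ} {𝒦 : Set (E k)}

instance (Q : Distn 𝒦) : IsProbabilityMeasure Q.toMeasure := Q.2.1

theorem Distn.measurable_toMeasure : Measurable (Distn.toMeasure : Distn 𝒦 → Measure (E k)) :=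
  measurable_subtype_coe

theorem Distn.toMeasure_compl (Q : Distn 𝒦) : Q.toMeasure 𝒦ᶜ = 0 := Q.2.2.1

theorem Distn.absolutelyContinuous (Q : Distn 𝒦) : Q.toMeasure ≪ volume := Q.2.2.2

theorem Distn.integrable_density (Q : Distn 𝒦) : Integrable Q.density :=
  Measure.integrable_toReal_rnDeriv

/-- The evaluation `Q ↦ Q` of elements of `𝔻` as a Markov kernel. -/
noncomputable def Distn.kernel (𝒦 : Set (E k)) : Kernel (Distn 𝒦) (E k) where
  toFun := Distn.toMeasure
  measurable' := Distn.measurable_toMeasure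

instance : IsMarkovKernel (Distn.kernel 𝒦) := ⟨fun Q => inferInstanceAs
  (IsProbabilityMeasure Q.toMeasure)⟩

/-- A version of the densities that is jointly measurable. -/
noncomputable def jointDensity (Q : Distn 𝒦) (x : E k) : ℝ :=
  𝒦.indicator (fun x => ((Distn.kernel 𝒦).rnDeriv
    (Kernel.const _ (volume.restrict 𝒦)) Q x).toReal) x

theorem measurable_jointDensity (h𝒦 : IsCompact 𝒦) :
    Measurable fun z : Distn 𝒦 × E k => jointDensity z.1 z.2 := by
  have h := (Kernel.measurable_rnDeriv (Distn.kernel 𝒦)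
    (Kernel.const _ (volume.restrict 𝒦))).ennreal_toReal
  exact h.indicator (measurable_snd h𝒦.measurableSet)

theorem Distn.density_ae_eq_zero (h𝒦 : IsCompact 𝒦) (Q : Distn 𝒦) :
    ∀ᵐ x, x ∈ 𝒦ᶜ → Q.density x = 0 := by
  have h1 : Q.toMeasure 𝒦ᶜ = ∫⁻ x in 𝒦ᶜ, Q.toMeasure.rnDeriv volume x := by
    conv_lhs => rw [← Measure.withDensity_rnDeriv_eq _ _ Q.absolutelyContinuous]
    rw [withDensity_apply _ h𝒦.measurableSet.compl]
  rw [Q.toMeasure_compl, eq_comm, lintegral_eq_zero_iff (Measure.measurable_rnDeriv _ _)] at h1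
  rw [← ae_restrict_iff' h𝒦.measurableSet.compl]
  filter_upwards [h1] with x hx
  simp [Distn.density, hx]

/-- `density` is a Radon–Nikodym derivative chosen separately for each `Q`, with no control in `Q`.
L₁ distances see only a.e. classes, so they may be computed from the kernel version. Restricting
Lebesgue measure to `𝒦` makes the reference measure finite and loses nothing, because `Q` lives on
`𝒦`. -/
theorem density_ae_eq_jointDensity (h𝒦 : IsCompact 𝒦) (Q : Distn 𝒦) :
    Q.density =ᵐ[volume] jointDensity Q := by
  have hfin : IsFiniteMeasure (volume.restrict 𝒦) :=
    ⟨by simpa using h𝒦.measure_lt_top⟩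
  have h1 := (Distn.kernel 𝒦).rnDeriv_eq_rnDeriv_measure
    (η := Kernel.const _ (volume.restrict 𝒦)) (a := Q)
  have hQ : Q.toMeasure = (volume.restrict 𝒦).withDensity (Q.toMeasure.rnDeriv volume) := by
    rw [← restrict_withDensity h𝒦.measurableSet,
      Measure.withDensity_rnDeriv_eq _ _ Q.absolutelyContinuous,
      Measure.restrict_eq_self_of_ae_mem]
    exact mem_ae_iff.2 Q.toMeasure_compl
  have h2 : Q.toMeasure.rnDeriv (volume.restrict 𝒦) =ᵐ[volume.restrict 𝒦]
      Q.toMeasure.rnDeriv volume := by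
    conv_lhs => rw [hQ]
    exact Measure.rnDeriv_withDensity _ (Measure.measurable_rnDeriv _ _)
  have h3 : ∀ᵐ x, x ∈ 𝒦 → (Distn.kernel 𝒦).rnDeriv
      (Kernel.const _ (volume.restrict 𝒦)) Q x = Q.toMeasure.rnDeriv volume x := by
    rw [← ae_restrict_iff' h𝒦.measurableSet]
    exact h1.trans h2
  filter_upwards [h3, Q.density_ae_eq_zero h𝒦] with x hx1 hx2
  by_cases hx : x ∈ 𝒦
  · rw [jointDensity, Set.indicator_of_mem hx, hx1 hx]; rfl
  · rw [jointDensity, Set.indicator_of_notMem hx, hx2 hx]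

theorem L1dist_congr_ae {p q p' q' : E k → ℝ} (hp : p =ᵐ[volume] p') (hq : q =ᵐ[volume] q') :
    L1dist p q = L1dist p' q' := by
  refine integral_congr_ae ?_
  filter_upwards [hp, hq] with x h1 h2
  rw [h1, h2]

theorem L1dist_nonneg (p q : E k → ℝ) : 0 ≤ L1dist p q := integral_nonneg fun _ => abs_nonneg _

theorem L1dist_comm (p q : E k → ℝ) : L1dist p q = L1dist q p := by
  simp only [L1dist, abs_sub_comm]

theorem L1dist_triangle {p q s : E k → ℝ} (hp : Integrable p) (hq : Integrable q)
    (hs : Integrable s) : L1dist p s ≤ L1dist p q + L1dist q s := by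
  unfold L1dist
  have h1 : Integrable fun x => |p x - q x| := (hp.sub hq).abs
  have h2 : Integrable fun x => |q x - s x| := (hq.sub hs).abs
  rw [← integral_add h1 h2]
  exact integral_mono (hp.sub hs).abs (h1.add h2) fun x => abs_sub_le _ _ _

theorem abs_L1dist_sub_L1dist_le {p p' q q' : E k → ℝ} (hp : Integrable p) (hp' : Integrable p')
    (hq : Integrable q) (hq' : Integrable q') :
    |L1dist p' q' - L1dist p q| ≤ L1dist p' p + L1dist q' q := by
  rw [abs_le]
  constructor
  · have h1 := L1dist_triangle hp hp' hq
    have h2 := L1dist_triangle hp' hq' hq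
    rw [L1dist_comm p p'] at h1
    linarith
  · have h1 := L1dist_triangle hp' hp hq'
    have h2 := L1dist_triangle hp hq hq'
    rw [L1dist_comm q q'] at h2
    linarith

theorem measurable_L1dist {α : Type*} [MeasurableSpace α] {p q : α → E k → ℝ}
    (hp : Measurable fun z : α × E k => p z.1 z.2) (hq : Measurable fun z : α × E k => q z.1 z.2) :
    Measurable fun a => L1dist (p a) (q a) := by
  have h : Measurable fun z : α × E k => |p z.1 z.2 - q z.1 z.2| := (hp.sub hq).abs
  exact (h.stronglyMeasurable.integral_prod_right' (ν := volume)).measurable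

theorem measurable_D (h𝒦 : IsCompact 𝒦) : Measurable fun z : Distn 𝒦 × Distn 𝒦 => D z.1 z.2 := by
  have h : (fun z : Distn 𝒦 × Distn 𝒦 => D z.1 z.2) =
      fun z => L1dist (jointDensity z.1) (jointDensity z.2) := by
    funext z
    exact L1dist_congr_ae (density_ae_eq_jointDensity h𝒦 _) (density_ae_eq_jointDensity h𝒦 _)
  rw [h]
  have h1 : Measurable fun z : (Distn 𝒦 × Distn 𝒦) × E k => (z.1.1, z.2) := by fun_prop
  have h2 : Measurable fun z : (Distn 𝒦 × Distn 𝒦) × E k => (z.1.2, z.2) := by fun_prop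
  exact measurable_L1dist ((measurable_jointDensity h𝒦).comp h1)
    ((measurable_jointDensity h𝒦).comp h2)

theorem measurable_smallBall (h𝒦 : IsCompact 𝒦) (ν : Measure (Distn 𝒦)) [IsProbabilityMeasure ν]
    (t : ℝ) : Measurable fun Q => smallBall ν Q t := by
  have h : MeasurableSet {z : Distn 𝒦 × Distn 𝒦 | D z.2 z.1 ≤ t} :=
    measurableSet_le ((measurable_D h𝒦).comp measurable_swap) measurable_const
  exact measurable_measure_prodMk_left h

theorem measurable_L1dist_kde_density (h𝒦 : IsCompact 𝒦) {N : ℕ} {B : ℝ → ℝ} (hB : Measurable B)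
    (b : ℝ) : Measurable fun z : Distn 𝒦 × (Fin N → E k) => L1dist (kde B b z.2) z.1.density := by
  have h : (fun z : Distn 𝒦 × (Fin N → E k) => L1dist (kde B b z.2) z.1.density) =
      fun z => L1dist (kde B b z.2) (jointDensity z.1) := by
    funext z
    exact L1dist_congr_ae Filter.EventuallyEq.rfl (density_ae_eq_jointDensity h𝒦 _)
  rw [h]
  have h2 : Measurable fun z : (Distn 𝒦 × (Fin N → E k)) × E k => (z.1.1, z.2) := by fun_prop
  have h3 : Measurable fun z : (Distn 𝒦 × (Fin N → E k)) × E k => kde B b z.1.2 z.2 := by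
    unfold kde
    fun_prop
  have h4 : Measurable fun z : (Distn 𝒦 × (Fin N → E k)) × E k => jointDensity z.1.1 z.2 :=
    (measurable_jointDensity h𝒦).comp h2
  exact measurable_L1dist (p := fun z : Distn 𝒦 × (Fin N → E k) => kde B b z.2)
    (q := fun z : Distn 𝒦 × (Fin N → E k) => jointDensity z.1) h3 h4

end Density

/-! ### Disintegration of the law of a unit -/

section Law

variable {k : ℕ} {𝒦 : Set (E k)}

/-- The kernel `Q ↦ Q ⊗ ⋯ ⊗ Q` of i.i.d. samples of size `N`. -/
noncomputable def sampleKernel (𝒦 : Set (E k)) (N : ℕ) : Kernel (Distn 𝒦) (Fin N → E k) where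
  toFun Q := Measure.pi fun _ => Q.toMeasure
  measurable' := by
    have : ∀ Q : Distn 𝒦, IsProbabilityMeasure (Measure.pi fun _ : Fin N => Q.toMeasure) :=
      fun Q => inferInstance
    refine Measurable.measure_of_isPiSystem_of_isProbabilityMeasure generateFrom_pi.symm
      isPiSystem_pi ?_
    rintro _ ⟨s, hs, rfl⟩
    have hs' : ∀ j, MeasurableSet (s j) := fun j => hs j (Set.mem_univ j)
    simp only [Measure.pi_pi]
    exact Finset.measurable_fun_prod _ fun i _ =>
      (Measure.measurable_coe (hs' i)).comp Distn.measurable_toMeasure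

instance (N : ℕ) : IsMarkovKernel (sampleKernel 𝒦 N) :=
  ⟨fun Q => inferInstanceAs (IsProbabilityMeasure (Measure.pi fun _ : Fin N => Q.toMeasure))⟩

variable {Ω : Type*} [MeasurableSpace Ω] {μ : Measure Ω} [IsProbabilityMeasure μ]
  {ν : Measure (Distn 𝒦)} [IsProbabilityMeasure ν] {f : Distn 𝒦 → ℝ} {m : ℕ}
  {N : Fin (m + 1) → ℕ} {P : Fin (m + 1) → Ω → Distn 𝒦}
  {X : (i : Fin (m + 1)) → Fin (N i) → Ω → E k} {Y : Fin (m + 1) → Ω → ℝ}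

/-- The model prescribes the law on rectangles only; these form a generating π-system. The
disintegration then allows risk bounds at a fixed `Q` to be integrated over `ν`. -/
theorem IsModel.map_eq_compProd (hmod : IsModel μ ν f N P X Y) (i : Fin (m + 1)) :
    μ.map (fun ω => (P i ω, fun j => X i j ω)) = ν ⊗ₘ sampleKernel 𝒦 (N i) := by
  have hm : Measurable fun ω => (P i ω, fun j => X i j ω) :=
    (hmod.measurable_P i).prodMk (measurable_pi_lambda _ (hmod.measurable_X i))
  have : IsProbabilityMeasure (μ.map (fun ω => (P i ω, fun j => X i j ω))) :=
    Measure.isProbabilityMeasure_map hm.aemeasurable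
  refine ext_of_generate_finite _ (generateFrom_eq_prod
    (MeasurableSpace.generateFrom_measurableSet (α := Distn 𝒦)) generateFrom_pi isCountablySpanning_measurableSet
    (IsCountablySpanning.pi fun _ => isCountablySpanning_measurableSet)).symm
    (MeasurableSpace.isPiSystem_measurableSet.prod isPiSystem_pi) ?_ (by simp)
  rintro _ ⟨A, hA, _, ⟨S, hS, rfl⟩, rfl⟩
  replace hA : MeasurableSet A := hA
  have hS' : ∀ j, MeasurableSet (S j) := fun j => hS j (Set.mem_univ j)
  beta_reduce
  rw [Measure.map_apply hm (hA.prod (MeasurableSet.univ_pi hS')),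
    Measure.compProd_apply_prod hA (MeasurableSet.univ_pi hS')]
  have h1 : (fun ω => (P i ω, fun j => X i j ω)) ⁻¹' A ×ˢ Set.univ.pi S =
      {ω | P i ω ∈ A ∧ ∀ j, X i j ω ∈ S j} := by
    ext ω; simp
  rw [h1, hmod.law i A hA S hS']
  refine lintegral_congr fun Q => ?_
  exact (Measure.pi_pi _ _).symm

theorem IsModel.lintegral_eq (hmod : IsModel μ ν f N P X Y) (i : Fin (m + 1))
    {F : Distn 𝒦 × (Fin (N i) → E k) → ℝ≥0∞} (hF : Measurable F) :
    ∫⁻ ω, F (P i ω, fun j => X i j ω) ∂μ =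
      ∫⁻ Q, ∫⁻ x, F (Q, x) ∂(Measure.pi fun _ => Q.toMeasure) ∂ν := by
  have hm : Measurable fun ω => (P i ω, fun j => X i j ω) :=
    (hmod.measurable_P i).prodMk (measurable_pi_lambda _ (hmod.measurable_X i))
  rw [← lintegral_map hF hm, hmod.map_eq_compProd, Measure.lintegral_compProd hF]
  rfl

theorem IsModel.map_P (hmod : IsModel μ ν f N P X Y) (i : Fin (m + 1)) : μ.map (P i) = ν := by
  have hm : Measurable fun ω => (P i ω, fun j => X i j ω) :=
    (hmod.measurable_P i).prodMk (measurable_pi_lambda _ (hmod.measurable_X i))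
  rw [← Measure.fst_compProd ν (sampleKernel 𝒦 (N i)), ← hmod.map_eq_compProd i, Measure.fst,
    Measure.map_map measurable_fst hm]
  rfl

end Law

/-! ### L₁ risk of the kernel density estimator -/

section KernelDensity

variable {k : ℕ} {𝒦 : Set (E k)} {B : ℝ → ℝ} {b : ℝ}

/-- The rescaled smoothing kernel `x ↦ b⁻ᵏ B(‖x‖ / b)` on `ℝᵏ`. -/
noncomputable def scaledKernel (B : ℝ → ℝ) (b : ℝ) (x : E k) : ℝ := 1 / b ^ k * B (‖x‖ / b)

theorem measurable_scaledKernel (hB : Measurable B) :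
    Measurable (scaledKernel B b : E k → ℝ) := by
  unfold scaledKernel
  fun_prop

theorem kde_eq_sum {N : ℕ} (X : Fin N → E k) (x : E k) :
    kde B b X x = (1 / (N : ℝ)) * ∑ j, scaledKernel B b (x - X j) := rfl

theorem integral_comp_norm_div (G : ℝ → ℝ) (hb : 0 < b) :
    ∫ x : E k, G (‖x‖ / b) = b ^ k * ∫ x : E k, G ‖x‖ := by
  have h := Measure.integral_comp_inv_smul_of_nonneg (volume : Measure (E k))
    (fun x => G ‖x‖) hb.le
  simp only [norm_smul, norm_inv, Real.norm_eq_abs, abs_of_pos hb, finrank_euclideanSpace,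
    Fintype.card_fin, smul_eq_mul] at h
  simpa only [div_eq_inv_mul] using h

theorem integrable_of_bounded_of_eq_zero {g : E k → ℝ} (hg : Measurable g) {M ρ : ℝ}
    (hM : ∀ x, |g x| ≤ M) (h0 : ∀ x, ρ < ‖x‖ → g x = 0) : Integrable g := by
  have hs : Function.support g ⊆ Metric.closedBall 0 ρ := fun x hx => by
    by_contra h
    exact hx (h0 x (by simpa using h))
  rw [← integrableOn_iff_integrable_of_support_subset hs]
  exact Measure.integrableOn_of_bounded (M := M) measure_closedBall_lt_top.ne
    hg.aestronglyMeasurable (ae_of_all _ fun x => hM x)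

variable {M ρ : ℝ}

theorem abs_scaledKernel_le (hb : 0 < b) (hM : ∀ u, 0 ≤ u → |B u| ≤ M) (x : E k) :
    |scaledKernel B b x| ≤ 1 / b ^ k * M := by
  rw [scaledKernel, abs_mul, abs_of_nonneg (by positivity)]
  gcongr
  exact hM _ (by positivity)

theorem scaledKernel_eq_zero (hb : 0 < b) (hρ : ∀ u, ρ < u → B u = 0) {x : E k}
    (hx : ρ * b < ‖x‖) : scaledKernel B b x = 0 := by
  rw [scaledKernel, hρ _ ((lt_div_iff₀ hb).2 hx), mul_zero]

theorem integrable_scaledKernel (hB : Measurable B) (hb : 0 < b) (hM : ∀ u, 0 ≤ u → |B u| ≤ M)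
    (hρ : ∀ u, ρ < u → B u = 0) : Integrable (scaledKernel B b : E k → ℝ) :=
  integrable_of_bounded_of_eq_zero (measurable_scaledKernel hB) (abs_scaledKernel_le hb hM)
    fun _ hx => scaledKernel_eq_zero hb hρ hx

theorem integrable_kde (hB : Measurable B) (hb : 0 < b) (hM : ∀ u, 0 ≤ u → |B u| ≤ M)
    (hρ : ∀ u, ρ < u → B u = 0) {N : ℕ} (X : Fin N → E k) : Integrable (kde B b X) := by
  have h : Integrable fun x => (1 / (N : ℝ)) * ∑ j, scaledKernel B b (x - X j) :=
    (integrable_finsetSum _ fun j _ =>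
      (integrable_scaledKernel hB hb hM hρ).comp_sub_right (X j)).const_mul _
  exact h

theorem integral_scaledKernel (hb : 0 < b) (h1 : ∫ x : E k, B ‖x‖ = 1) :
    ∫ x : E k, scaledKernel B b x = 1 := by
  unfold scaledKernel
  rw [integral_const_mul, integral_comp_norm_div B hb, h1]
  field_simp

theorem integral_abs_scaledKernel (hb : 0 < b) :
    ∫ x : E k, |scaledKernel B b x| = ∫ x : E k, |B ‖x‖| := by
  unfold scaledKernel
  simp only [abs_mul, abs_of_nonneg (show (0 : ℝ) ≤ 1 / b ^ k by positivity)]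
  rw [integral_const_mul, integral_comp_norm_div (fun u => |B u|) hb]
  field_simp

theorem integral_sq_scaledKernel (hb : 0 < b) :
    ∫ x : E k, scaledKernel B b x ^ 2 = 1 / b ^ k * ∫ x : E k, B ‖x‖ ^ 2 := by
  unfold scaledKernel
  simp only [mul_pow]
  rw [integral_const_mul, integral_comp_norm_div (fun u => B u ^ 2) hb]
  field_simp

/-- Bias of the kernel density estimator at a Lipschitz density. -/
theorem abs_integral_scaledKernel_mul_sub_le (hB : Measurable B) (hb : 0 < b)
    (hM : ∀ u, 0 ≤ u → |B u| ≤ M) (hρ : ∀ u, ρ < u → B u = 0) (h1 : ∫ x : E k, B ‖x‖ = 1)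
    {Λ : ℝ≥0} {p : E k → ℝ} (hp : LipschitzWith Λ p) (hpi : Integrable p) (x : E k) :
    |(∫ y, scaledKernel B b (x - y) * p y) - p x| ≤ Λ * (ρ * b) * ∫ u : E k, |B ‖u‖| := by
  have hg : Integrable fun y => scaledKernel B b (x - y) :=
    (integrable_scaledKernel hB hb hM hρ).comp_sub_left x
  have hgp : Integrable fun y => scaledKernel B b (x - y) * p y :=
    hpi.bdd_mul hg.aestronglyMeasurable (ae_of_all _ fun y => abs_scaledKernel_le hb hM _)
  -- The kernel has integral one, so the bias averages `p y - p x` over `‖x - y‖ ≤ ρ * b`, where the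
  -- Lipschitz bound is at most `Λ * (ρ * b)`.
  have hpx : p x = ∫ y, scaledKernel B b (x - y) * p x := by
    rw [integral_mul_const, integral_sub_left_eq_self, integral_scaledKernel hb h1, one_mul]
  conv_lhs => rw [hpx]
  rw [← integral_sub hgp (hg.mul_const _)]
  refine (abs_integral_le_integral_abs).trans ?_
  rw [← integral_abs_scaledKernel hb,
    ← integral_sub_left_eq_self (fun y => |scaledKernel B b y|) volume x, ← integral_const_mul]
  refine integral_mono (hgp.sub (hg.mul_const _)).abs (hg.abs.const_mul _) fun y => ?_
  simp only
  rw [← mul_sub, abs_mul, mul_comm]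
  rcases lt_or_ge (ρ * b) ‖x - y‖ with h | h
  · simp [scaledKernel_eq_zero hb hρ h]
  · gcongr
    have := hp.dist_le_mul y x
    rw [Real.dist_eq, dist_comm, dist_eq_norm] at this
    exact this.trans (by gcongr)

/-- Variance bound for a sample mean. -/
theorem integral_sq_mean_sub_le {Q : Measure (E k)} [IsProbabilityMeasure Q] {φ : E k → ℝ}
    (hφ : MemLp φ 2 Q) {N : ℕ} (hN : 0 < N) :
    ∫ X : Fin N → E k, ((1 / (N : ℝ)) * ∑ j, φ (X j) - ∫ y, φ y ∂Q) ^ 2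
        ∂(Measure.pi fun _ => Q) ≤ (1 / (N : ℝ)) * ∫ y, φ y ^ 2 ∂Q := by
  have hNR : (0 : ℝ) < N := by exact_mod_cast hN
  have hφj : ∀ j : Fin N, MemLp (fun X : Fin N → E k => φ (X j)) 2 (Measure.pi fun _ => Q) :=
    fun j => hφ.comp_measurePreserving (measurePreserving_eval (fun _ => Q) j)
  have hmean : ∀ j : Fin N, ∫ X : Fin N → E k, φ (X j) ∂(Measure.pi fun _ => Q) = ∫ y, φ y ∂Q := by
    intro j
    have h := (measurePreserving_eval (fun _ : Fin N => Q) j).map_eq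
    conv_rhs => rw [← h]
    rw [integral_map (measurable_pi_apply j).aemeasurable]
    rw [h]
    exact hφ.aestronglyMeasurable
  have hS : ∫ X : Fin N → E k, ∑ j, φ (X j) ∂(Measure.pi fun _ => Q) = N * ∫ y, φ y ∂Q := by
    rw [integral_finsetSum _ fun j _ => (hφj j).integrable one_le_two]
    simp [hmean]
  have hvar : Var[fun X : Fin N → E k => ∑ j, φ (X j); Measure.pi fun _ => Q] =
      N * Var[φ; Q] := by
    have h := variance_sum_pi (μ := fun _ : Fin N => Q) (X := fun _ => φ) fun _ => hφ
    have h2 : (∑ i, fun ω : Fin N → E k => φ (ω i)) = fun X : Fin N → E k => ∑ j, φ (X j) := by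
      funext X; simp
    rw [h2] at h
    rw [h]; simp
  have hm : AEStronglyMeasurable (fun X : Fin N → E k => ∑ j, φ (X j)) (Measure.pi fun _ => Q) :=
    (memLp_finsetSum _ fun j _ => hφj j).aestronglyMeasurable
  rw [variance_eq_integral hm.aemeasurable, hS] at hvar
  have h3 : ∀ X : Fin N → E k, ((1 / (N : ℝ)) * ∑ j, φ (X j) - ∫ y, φ y ∂Q) ^ 2 =
      (1 / (N : ℝ)) ^ 2 * (∑ j, φ (X j) - N * ∫ y, φ y ∂Q) ^ 2 := by
    intro X
    rw [← mul_pow]; congr 1; field_simp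
  simp only [h3]
  rw [integral_const_mul, hvar, sq, mul_assoc, ← mul_assoc _ (N : ℝ), one_div_mul_cancel hNR.ne',
    one_mul]
  gcongr
  exact variance_le_expectation_sq hφ.aestronglyMeasurable

/-- The inequality of arithmetic and geometric means at scale `b`. It bounds the mean of `|z|`
linearly in the second moment, so the variance can be integrated over `x` without a square root. -/
theorem abs_le_half_add_sq_div (hb : 0 < b) (z : ℝ) : |z| ≤ b / 2 + 1 / (2 * b) * z ^ 2 := by
  have h : 0 ≤ (|z| - b) ^ 2 / (2 * b) := by positivity
  have h2 : (|z| - b) ^ 2 / (2 * b) = b / 2 + 1 / (2 * b) * z ^ 2 - |z| := by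
    rw [sub_sq, sq_abs]; field_simp; ring
  linarith

theorem HasHolderDensity.exists_density {Λ : ℝ≥0} {Q : Distn 𝒦} (hQ : HasHolderDensity Λ Q) :
    ∃ p : E k → ℝ, (∀ x, 0 ≤ p x) ∧ LipschitzWith Λ p ∧ Integrable p ∧ Q.density =ᵐ[volume] p ∧
      Q.toMeasure = volume.withDensity (fun x => ENNReal.ofReal (p x)) := by
  obtain ⟨p, hp0, hpL, hQp⟩ := hQ
  have hpm : Measurable fun x => ENNReal.ofReal (p x) :=
    hpL.continuous.measurable.ennreal_ofReal
  have hae : Q.density =ᵐ[volume] p := by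
    have h := Measure.rnDeriv_withDensity volume hpm
    rw [← hQp] at h
    filter_upwards [h] with x hx
    rw [Distn.density, hx, ENNReal.toReal_ofReal (hp0 x)]
  exact ⟨p, hp0, hpL, Q.integrable_density.congr hae, hae, hQp⟩

/-- Pointwise risk of the kernel density estimator at a Lipschitz density. -/
theorem lintegral_abs_kde_sub_le (hB : Measurable B) (hb : 0 < b)
    (hM : ∀ u, 0 ≤ u → |B u| ≤ M) (hρ0 : 0 ≤ ρ) (hρ : ∀ u, ρ < u → B u = 0)
    (h1 : ∫ x : E k, B ‖x‖ = 1)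
    {Λ : ℝ≥0} {Q : Measure (E k)} [IsProbabilityMeasure Q] {p : E k → ℝ} (hp0 : ∀ x, 0 ≤ p x)
    (hp : LipschitzWith Λ p) (hpi : Integrable p)
    (hQ : Q = volume.withDensity fun x => ENNReal.ofReal (p x)) {N : ℕ} (hN : 0 < N) (x : E k) :
    ∫⁻ X : Fin N → E k, ENNReal.ofReal |kde B b X x - p x| ∂(Measure.pi fun _ => Q) ≤
      ENNReal.ofReal (b / 2 + Λ * (ρ * b) * ∫ u : E k, |B ‖u‖|) +
        ENNReal.ofReal (1 / (2 * b) * (1 / (N : ℝ))) *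
          ∫⁻ y, ENNReal.ofReal (scaledKernel B b (x - y) ^ 2) ∂Q := by
  set φ : E k → ℝ := fun y => scaledKernel B b (x - y) with hφdef
  have hφm : Measurable φ := by
    have := measurable_scaledKernel (k := k) (b := b) hB
    fun_prop
  have hφ : MemLp φ 2 Q := MemLp.of_bound hφm.aestronglyMeasurable _
    (ae_of_all _ fun y => abs_scaledKernel_le hb hM _)
  have hG : ∫ y, φ y ∂Q = ∫ y, scaledKernel B b (x - y) * p y := by
    rw [hQ, integral_withDensity_eq_integral_toReal_smul
      hp.continuous.measurable.ennreal_ofReal (ae_of_all _ fun _ => ENNReal.ofReal_lt_top)]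
    refine integral_congr_ae (ae_of_all _ fun y => ?_)
    simp only [ENNReal.toReal_ofReal (hp0 y), smul_eq_mul, hφdef, mul_comm]
  have hbias := abs_integral_scaledKernel_mul_sub_le hB hb hM hρ h1 hp hpi x
  rw [← hG] at hbias
  have hvar := integral_sq_mean_sub_le hφ hN
  set Z : (Fin N → E k) → ℝ := fun X => (1 / (N : ℝ)) * ∑ j, φ (X j) - ∫ y, φ y ∂Q with hZ
  have hφj : ∀ j : Fin N, MemLp (fun X : Fin N → E k => φ (X j)) 2 (Measure.pi fun _ => Q) :=
    fun j => hφ.comp_measurePreserving (measurePreserving_eval (fun _ => Q) j)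
  have hsumL : MemLp (fun X : Fin N → E k => ∑ j, φ (X j)) 2 (Measure.pi fun _ => Q) :=
    memLp_finsetSum _ fun j _ => hφj j
  have hZL : MemLp Z 2 (Measure.pi fun _ => Q) := (hsumL.const_mul _).sub (memLp_const _)
  have hc : 0 ≤ b / 2 + Λ * (ρ * b) * ∫ u : E k, |B ‖u‖| := by
    have : 0 ≤ ∫ u : E k, |B ‖u‖| := integral_nonneg fun _ => abs_nonneg _
    positivity
  calc ∫⁻ X : Fin N → E k, ENNReal.ofReal |kde B b X x - p x| ∂(Measure.pi fun _ => Q)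
      ≤ ∫⁻ X : Fin N → E k, (ENNReal.ofReal (b / 2 + Λ * (ρ * b) * ∫ u : E k, |B ‖u‖|) +
          ENNReal.ofReal (1 / (2 * b)) * ENNReal.ofReal (Z X ^ 2)) ∂(Measure.pi fun _ => Q) := by
        refine lintegral_mono fun X => ?_
        rw [← ENNReal.ofReal_mul (by positivity), ← ENNReal.ofReal_add hc (by positivity)]
        refine ENNReal.ofReal_le_ofReal ?_
        have h2 : kde B b X x - p x = Z X + ((∫ y, φ y ∂Q) - p x) := by
          rw [kde_eq_sum, hZ]; ring
        rw [h2]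
        refine (abs_add_le _ _).trans ?_
        linarith [abs_le_half_add_sq_div hb (Z X)]
    _ = ENNReal.ofReal (b / 2 + Λ * (ρ * b) * ∫ u : E k, |B ‖u‖|) +
          ENNReal.ofReal (1 / (2 * b)) * ENNReal.ofReal
            (∫ X, Z X ^ 2 ∂(Measure.pi fun _ => Q)) := by
        rw [lintegral_add_left measurable_const, lintegral_const, measure_univ, mul_one,
          lintegral_const_mul' _ _ ENNReal.ofReal_ne_top,
          ofReal_integral_eq_lintegral_ofReal hZL.integrable_sq (ae_of_all _ fun _ => sq_nonneg _)]
    _ ≤ _ := by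
        rw [← ofReal_integral_eq_lintegral_ofReal hφ.integrable_sq
          (ae_of_all _ fun _ => sq_nonneg _), ENNReal.ofReal_mul (p := 1 / (2 * b)) (by positivity),
          mul_assoc (ENNReal.ofReal (1 / (2 * b))), ← ENNReal.ofReal_mul (p := 1 / (N : ℝ)) (by positivity)]
        gcongr

/-- The `L₁` risk of the kernel density estimator is of the order of the bandwidth, uniformly over
the distributions on a compact set with a `Λ`-Lipschitz density. -/
theorem exists_lintegral_L1dist_kde_le (h𝒦 : IsCompact 𝒦) (Λ : ℝ≥0) (hB : IsSmoothingKernel k B) :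
    ∃ C : ℝ, 0 < C ∧ ∀ Q : Distn 𝒦, HasHolderDensity Λ Q → ∀ (N : ℕ) (b : ℝ), 0 < b → b ≤ 1 →
      1 ≤ N * b ^ (k + 2) →
      ∫⁻ X : Fin N → E k, ENNReal.ofReal (L1dist (kde B b X) Q.density)
        ∂(Measure.pi fun _ => Q.toMeasure) ≤ ENNReal.ofReal (C * b) := by
  obtain ⟨M, hM⟩ := hB.bounded
  obtain ⟨ρ', hρ'⟩ := hB.compactSupport
  obtain ⟨ρ, hρ0, hρ⟩ : ∃ ρ, 0 ≤ ρ ∧ ∀ u, ρ < u → B u = 0 :=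
    ⟨max ρ' 0, le_max_right _ _, fun u hu => hρ' u ((le_max_left _ _).trans_lt hu)⟩
  obtain ⟨R₀, hR₀⟩ := h𝒦.isBounded.subset_closedBall (0 : E k)
  -- For `b ≤ 1` and sample points in `𝒦`, both the estimator and the density vanish a.e. outside
  -- this ball, so pointwise bounds are integrated over a set of finite volume.
  set S : Set (E k) := Metric.closedBall 0 (R₀ + ρ) with hS
  have hSfin : volume S ≠ ∞ := measure_closedBall_lt_top.ne
  set A₁ : ℝ := ∫ u : E k, |B ‖u‖| with hA₁
  set A₂ : ℝ := ∫ u : E k, B ‖u‖ ^ 2 with hA₂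
  have hA₁0 : 0 ≤ A₁ := integral_nonneg fun _ => abs_nonneg _
  have hA₂0 : 0 ≤ A₂ := integral_nonneg fun _ => sq_nonneg _
  -- On `S`, `1 / 2` comes from the arithmetic-geometric step and `Λ * ρ * A₁` from the bias; `A₂ /
  -- 2` is the integrated variance, and `+ 1` ensures positivity.
  refine ⟨(1 / 2 + Λ * ρ * A₁) * (volume S).toReal + A₂ / 2 + 1, by positivity, ?_⟩
  intro Q hQ N b hb hb1 hNb
  obtain ⟨p, hp0, hpL, hpi, hdp, hQp⟩ := hQ.exists_density
  have hN : 0 < N := by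
    rcases Nat.eq_zero_or_pos N with rfl | h
    · norm_num at hNb
    · exact h
  have hNR : (0 : ℝ) < N := by exact_mod_cast hN
  have hgm := measurable_scaledKernel (k := k) (b := b) hB.measurable
  have hkm : Measurable fun z : (Fin N → E k) × E k => ENNReal.ofReal |kde B b z.1 z.2 - p z.2| := by
    have h1 : Measurable fun z : (Fin N → E k) × E k => kde B b z.1 z.2 := by
      have := hB.measurable
      unfold kde
      fun_prop
    have h2 : Measurable fun z : (Fin N → E k) × E k => p z.2 :=
      hpL.continuous.measurable.comp measurable_snd
    exact (h1.sub h2).abs.ennreal_ofReal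
  have hX𝒦 : ∀ᵐ X ∂(Measure.pi fun _ : Fin N => Q.toMeasure), ∀ j, X j ∈ 𝒦 := by
    rw [ae_all_iff]
    intro j
    exact (measurePreserving_eval (fun _ : Fin N => Q.toMeasure) j).quasiMeasurePreserving.ae
      (p := fun x => x ∈ 𝒦) (mem_ae_iff.2 Q.toMeasure_compl)
  have hloc : ∀ᵐ X ∂(Measure.pi fun _ : Fin N => Q.toMeasure),
      ENNReal.ofReal (L1dist (kde B b X) Q.density) ≤
        ∫⁻ x in S, ENNReal.ofReal |kde B b X x - p x| := by
    filter_upwards [hX𝒦] with X hX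
    have hI : Integrable fun x => |kde B b X x - p x| :=
      ((integrable_kde hB.measurable hb hM hρ X).sub hpi).abs
    rw [L1dist_congr_ae Filter.EventuallyEq.rfl hdp, L1dist, integral_eq_lintegral_of_nonneg_ae
      (ae_of_all _ fun _ => abs_nonneg _) hI.aestronglyMeasurable]
    refine ENNReal.ofReal_toReal_le.trans ?_
    rw [← lintegral_indicator Metric.isClosed_closedBall.measurableSet]
    refine lintegral_mono_ae ?_
    filter_upwards [hdp, Q.density_ae_eq_zero h𝒦] with x hx1 hx2
    by_cases hxS : x ∈ S
    · rw [Set.indicator_of_mem hxS]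
    · have hxn : R₀ + ρ < ‖x‖ := by simpa [hS] using hxS
      have hx𝒦 : x ∈ 𝒦ᶜ := fun h => by
        have := hR₀ h
        rw [mem_closedBall_zero_iff] at this
        linarith
      have hk0 : kde B b X x = 0 := by
        rw [kde_eq_sum, Finset.sum_eq_zero, mul_zero]
        intro j _
        refine scaledKernel_eq_zero hb hρ ?_
        have h1 := hR₀ (hX j)
        rw [mem_closedBall_zero_iff] at h1
        have h2 := norm_sub_norm_le x (X j)
        have h3 : ρ * b ≤ ρ := mul_le_of_le_one_right hρ0 hb1
        linarith
      rw [hk0, ← hx1, hx2 hx𝒦]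
      simp
  -- Integrating over `x` first, translation invariance removes `y`, so no bound on the supremum of
  -- the density is needed.
  have hsq : ∫⁻ x, ∫⁻ y, ENNReal.ofReal (scaledKernel B b (x - y) ^ 2) ∂Q.toMeasure =
      ENNReal.ofReal (1 / b ^ k * A₂) := by
    rw [lintegral_lintegral_swap (by fun_prop)]
    have h2 : Integrable fun x : E k => scaledKernel B b x ^ 2 := by
      refine integrable_of_bounded_of_eq_zero (hgm.pow_const 2) (M := (1 / b ^ k * M) ^ 2)
        (ρ := ρ * b) (fun x => ?_) fun x hx => by simp [scaledKernel_eq_zero hb hρ hx]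
      rw [abs_pow]
      gcongr
      exact abs_scaledKernel_le hb hM x
    have h3 : ∀ y : E k, ∫⁻ x, ENNReal.ofReal (scaledKernel B b (x - y) ^ 2) =
        ENNReal.ofReal (1 / b ^ k * A₂) := by
      intro y
      rw [lintegral_sub_right_eq_self (fun x => ENNReal.ofReal (scaledKernel B b x ^ 2)) y,
        ← ofReal_integral_eq_lintegral_ofReal h2 (ae_of_all _ fun _ => sq_nonneg _),
        integral_sq_scaledKernel hb]
    simp only [h3, lintegral_const, measure_univ, mul_one]
  obtain ⟨c, hc⟩ : ∃ c, c = b / 2 + Λ * (ρ * b) * A₁ := ⟨_, rfl⟩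
  have hc0 : 0 ≤ c := by rw [hc]; positivity
  calc ∫⁻ X : Fin N → E k, ENNReal.ofReal (L1dist (kde B b X) Q.density)
        ∂(Measure.pi fun _ => Q.toMeasure)
      ≤ ∫⁻ X : Fin N → E k, (∫⁻ x in S, ENNReal.ofReal |kde B b X x - p x|)
        ∂(Measure.pi fun _ => Q.toMeasure) := lintegral_mono_ae hloc
    _ = ∫⁻ x in S, ∫⁻ X : Fin N → E k, ENNReal.ofReal |kde B b X x - p x|
        ∂(Measure.pi fun _ => Q.toMeasure) := lintegral_lintegral_swap hkm.aemeasurable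
    _ ≤ ∫⁻ x in S, (ENNReal.ofReal (c) +
        ENNReal.ofReal (1 / (2 * b) * (1 / (N : ℝ))) *
          ∫⁻ y, ENNReal.ofReal (scaledKernel B b (x - y) ^ 2) ∂Q.toMeasure) :=
        lintegral_mono fun x => by
          rw [hc]
          exact lintegral_abs_kde_sub_le hB.measurable hb hM hρ0 hρ
            hB.integral_eq_one hp0 hpL hpi hQp hN x
    _ ≤ ENNReal.ofReal (c) * volume S +
        ENNReal.ofReal (1 / (2 * b) * (1 / (N : ℝ))) * ENNReal.ofReal (1 / b ^ k * A₂) := by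
        rw [lintegral_add_left measurable_const, setLIntegral_const,
          lintegral_const_mul' _ _ ENNReal.ofReal_ne_top, ← hsq]
        gcongr
        exact Measure.restrict_le_self
    _ = ENNReal.ofReal ((c) * (volume S).toReal +
          1 / (2 * b) * (1 / (N : ℝ)) * (1 / b ^ k * A₂)) := by
        rw [ENNReal.ofReal_add (by positivity) (by positivity),
          ENNReal.ofReal_mul (by positivity) (q := (volume S).toReal),
          ENNReal.ofReal_toReal hSfin, ENNReal.ofReal_mul (by positivity) (q := 1 / b ^ k * A₂)]
    _ ≤ _ := by
        refine ENNReal.ofReal_le_ofReal ?_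
        -- Isolates `1 / (N * b ^ (k + 2))`, which is at most one: the variance contribution is then
        -- of order `b`, like the bias.
        have h4 : 1 / (2 * b) * (1 / (N : ℝ)) * (1 / b ^ k * A₂) =
            A₂ / 2 * b * (1 / (N * b ^ (k + 2))) := by
          field_simp
          ring
        have h5 : A₂ / 2 * b * (1 / (N * b ^ (k + 2))) ≤ A₂ / 2 * b * 1 := by
          gcongr
          exact (div_le_one (by positivity)).2 hNb
        rw [h4, hc]
        nlinarith [hb]

end KernelDensity

/-! ### Risk of the kernel-kernel estimator -/

section Risk

variable {k : ℕ} {𝒦 : Set (E k)} {K B : ℝ → ℝ} {LK : ℝ≥0} {κ r R : ℝ} {m : ℕ}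

/-- Nothing is known about `K` on negative arguments, not even measurability. This modification is
continuous and agrees with `K` on `[0, ∞)`, where all scaled distances lie. -/
theorem IsBoxedKernel.comp_max (hK : IsBoxedKernel K LK κ r R) :
    IsBoxedKernel (fun x => K (max x 0)) LK κ r R where
  nonneg x _ := hK.nonneg _ (le_max_right _ _)
  lipschitz := fun x hx y hy => by
    simpa only [max_eq_left (Set.mem_Ici.1 hx), max_eq_left (Set.mem_Ici.1 hy)] using
      hK.lipschitz hx hy
  lower x hx := by simpa only [max_eq_left hx.le] using hK.lower x hx
  upper x hx := by simpa only [max_eq_left hx.le] using hK.upper x hx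

theorem IsBoxedKernel.measurable_comp_max (hK : IsBoxedKernel K LK κ r R) :
    Measurable fun x => K (max x 0) :=
  (hK.lipschitz.continuousOn.comp_continuous (continuous_id.max continuous_const)
    fun _ => Set.mem_Ici.2 (le_max_right _ _)).measurable

theorem measurable_countLE (t : ℝ) : Measurable fun d : Fin m → ℝ => countLE t d := by
  simp only [countLE, Finset.card_filter]
  exact Finset.measurable_fun_sum _ fun j _ =>
    Measurable.ite (measurableSet_le (measurable_pi_apply j) measurable_const)
      measurable_const measurable_const

theorem measurable_regWeight (hK : Measurable K) (h t : ℝ) (i : Fin m) :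
    Measurable fun d : Fin m → ℝ => regWeight K h t d i := by
  unfold regWeight
  exact Measurable.ite (measurableSet_lt measurable_const (measurable_countLE t)) (by fun_prop)
    measurable_const

theorem invSmallBall_anti (ν : Measure (Distn 𝒦)) {s t : ℝ} (hst : s ≤ t) :
    invSmallBall ν t ≤ invSmallBall ν s :=
  lintegral_mono fun _ => ENNReal.inv_le_inv.2 (measure_mono fun _ hQ => le_trans hQ hst)

variable {Ω : Type*} [MeasurableSpace Ω] {μ : Measure Ω} {ν : Measure (Distn 𝒦)} {f : Distn 𝒦 → ℝ}
  {N : Fin (m + 1) → ℕ} {P : Fin (m + 1) → Ω → Distn 𝒦}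
  {X : (i : Fin (m + 1)) → Fin (N i) → Ω → E k} {Y : Fin (m + 1) → Ω → ℝ}

/-- The unit `i` reduced to its distribution, the `L₁` error of its density estimator and its
response. -/
noncomputable def unitSummary (B : ℝ → ℝ) (b : ℝ) (P : Fin (m + 1) → Ω → Distn 𝒦)
    (X : (i : Fin (m + 1)) → Fin (N i) → Ω → E k) (Y : Fin (m + 1) → Ω → ℝ) (i : Fin (m + 1))
    (ω : Ω) : Distn 𝒦 × ℝ × ℝ :=
  (P i ω, L1dist (kde B b fun j => X i j ω) (P i ω).density, Y i ω)

theorem measurable_unitSummary_aux (h𝒦 : IsCompact 𝒦) (hB : Measurable B) (b : ℝ) (n : ℕ) :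
    Measurable fun u : Distn 𝒦 × (Fin n → E k) × ℝ =>
      (u.1, L1dist (kde B b u.2.1) u.1.density, u.2.2) := by
  have h1 : Measurable fun u : Distn 𝒦 × (Fin n → E k) × ℝ => (u.1, u.2.1) := by fun_prop
  exact measurable_fst.prodMk
    (((measurable_L1dist_kde_density h𝒦 hB b).comp h1).prodMk measurable_snd.snd)

theorem IsModel.measurable_unitSummary (hmod : IsModel μ ν f N P X Y) (h𝒦 : IsCompact 𝒦)
    (hB : Measurable B) (b : ℝ) (i : Fin (m + 1)) : Measurable (unitSummary B b P X Y i) := by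
  have h1 : Measurable fun ω => (P i ω, (fun j => X i j ω), Y i ω) :=
    (hmod.measurable_P i).prodMk
      ((measurable_pi_lambda _ (hmod.measurable_X i)).prodMk (hmod.measurable_Y i))
  exact (measurable_unitSummary_aux h𝒦 hB b (N i)).comp h1

theorem IsModel.iIndepFun_unitSummary (hmod : IsModel μ ν f N P X Y) (h𝒦 : IsCompact 𝒦)
    (hB : Measurable B) (b : ℝ) : iIndepFun (unitSummary B b P X Y) μ :=
  hmod.indep.comp (fun _ u => (u.1, L1dist (kde B b u.2.1) u.1.density, u.2.2))
    fun i => measurable_unitSummary_aux h𝒦 hB b (N i)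

variable [IsProbabilityMeasure μ]

/-- The responses are centred at the regression function. -/
theorem IsModel.integral_noise_mul_eq_zero (hmod : IsModel μ ν f N P X Y) (hf : Measurable f)
    {M : ℝ} (i : Fin (m + 1)) (hM : ∀ᵐ ω ∂μ, |Y i ω - f (P i ω)| ≤ M) {G : Distn 𝒦 → ℝ}
    (hG : Measurable G) (hG1 : ∀ x, |G x| ≤ 1) :
    ∫ ω, (Y i ω - f (P i ω)) * G (P i ω) ∂μ = 0 := by
  have hm : Measurable fun ω => Y i ω - f (P i ω) :=
    (hmod.measurable_Y i).sub (hf.comp (hmod.measurable_P i))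
  exact integral_mul_comp_eq_zero (Integrable.of_bound hm.aestronglyMeasurable M hM)
    (hmod.measurable_P i) (hmod.noise i) hG hG1

variable [IsProbabilityMeasure ν]

theorem IsModel.ae_of_ae (hmod : IsModel μ ν f N P X Y) (i : Fin (m + 1)) {q : Distn 𝒦 → Prop}
    (hq : ∀ᵐ Q ∂ν, q Q) : ∀ᵐ ω ∂μ, q (P i ω) := by
  rw [← hmod.map_P i] at hq
  exact ae_of_ae_map (hmod.measurable_P i).aemeasurable hq

/-- Condition on `P i`: the weight `G (P i)` is then constant, and `φ` has conditional mean at most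
`a`. -/
theorem IsModel.lintegral_mul_le (hmod : IsModel μ ν f N P X Y) (i : Fin (m + 1))
    {φ : Distn 𝒦 × (Fin (N i) → E k) → ℝ≥0∞} (hφ : Measurable φ) {a : ℝ≥0∞}
    (ha : ∀ᵐ Q ∂ν, ∫⁻ x, φ (Q, x) ∂(Measure.pi fun _ => Q.toMeasure) ≤ a)
    {G : Distn 𝒦 → ℝ≥0∞} (hG : Measurable G) :
    ∫⁻ ω, φ (P i ω, fun j => X i j ω) * G (P i ω) ∂μ ≤ a * ∫⁻ Q, G Q ∂ν := by
  rw [hmod.lintegral_eq i (F := fun z => φ z * G z.1) (hφ.mul (hG.comp measurable_fst)),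
    ← lintegral_const_mul _ hG]
  refine lintegral_mono_ae ?_
  filter_upwards [ha] with Q hQ
  rw [lintegral_mul_const _ (hφ.of_uncurry_left (f := fun Q x => φ (Q, x)))]
  gcongr

theorem IsModel.lintegral_error_mul_le (hmod : IsModel μ ν f N P X Y) (h𝒦 : IsCompact 𝒦)
    (hB : Measurable B) {b : ℝ} (i : Fin (m + 1)) {a : ℝ≥0∞}
    (ha : ∀ᵐ Q ∂ν, ∫⁻ x : Fin (N i) → E k, ENNReal.ofReal (L1dist (kde B b x) Q.density)
      ∂(Measure.pi fun _ => Q.toMeasure) ≤ a) {G : Distn 𝒦 → ℝ≥0∞} (hG : Measurable G) :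
    ∫⁻ ω, ENNReal.ofReal (L1dist (kde B b fun j => X i j ω) (P i ω).density) * G (P i ω) ∂μ ≤
      a * ∫⁻ Q, G Q ∂ν :=
  hmod.lintegral_mul_le i (φ := fun z => ENNReal.ofReal (L1dist (kde B b z.2) z.1.density))
    (measurable_L1dist_kde_density h𝒦 hB b).ennreal_ofReal ha hG

theorem IsModel.measure_D_le (hmod : IsModel μ ν f N P X Y) (h𝒦 : IsCompact 𝒦) (t : ℝ)
    (i : Fin (m + 1)) (Q : Distn 𝒦) : μ {ω | D (P i ω) Q ≤ t} = smallBall ν Q t := by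
  have h : MeasurableSet {Q' : Distn 𝒦 | D Q' Q ≤ t} :=
    measurableSet_le ((measurable_D h𝒦).comp measurable_prodMk_right) measurable_const
  rw [smallBall, ← hmod.map_P i, Measure.map_apply (hmod.measurable_P i) h]
  rfl

/-- Risk bound for the kernel-kernel estimator when the density estimators have `L₁` risk at most
`a`. -/
theorem IsModel.lintegral_abs_kernelKernel_sub_le (hmod : IsModel μ ν f N P X Y)
    (h𝒦 : IsCompact 𝒦) (hB : IsSmoothingKernel k B) (hK : IsBoxedKernel K LK κ r R)
    (hKm : Measurable K) (hκ : 0 < κ) (hr : 0 < r) (hR : 0 ≤ R) (hf : Measurable f)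
    {L β F M : ℝ} (hL : 0 ≤ L) (hβ : 0 ≤ β) (hfL : IsHolderFunctional L β f)
    (hF0 : 0 ≤ F) (hF : ∀ᵐ Q ∂ν, |f Q| ≤ F) (hM0 : 0 ≤ M) (hM : ∀ i, ∀ᵐ ω ∂μ, |Y i ω| ≤ M)
    (hm : 0 < m) {h b : ℝ} (hh : 0 < h) (hb : 0 < b) {a : ℝ≥0∞}
    (ha : ∀ i, ∀ᵐ Q ∂ν, ∫⁻ x : Fin (N i) → E k, ENNReal.ofReal (L1dist (kde B b x) Q.density)
      ∂(Measure.pi fun _ => Q.toMeasure) ≤ a) :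
    ∫⁻ ω, ENNReal.ofReal |kernelKernel K B h b (fun i j => X i j ω) (fun i => Y i ω) -
        f (P (Fin.last m) ω)| ∂μ ≤
      ENNReal.ofReal (4 * M * LK / (κ * h)) *
          (a * invSmallBall ν (r * h) + a * invSmallBall ν (r * h)) +
        ENNReal.ofReal (L * R ^ β * h ^ β) +
        ENNReal.ofReal (M + F) *
          (ENNReal.ofReal (2 / κ) * (invSmallBall ν (r * h) / m)) ^ (1 / 2 : ℝ) +
        ENNReal.ofReal (M + F) * (invSmallBall ν (r * h) / m) := by
  obtain ⟨Bmax, hBmax⟩ := hB.bounded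
  obtain ⟨ρ, hρ⟩ := hB.compactSupport
  set V := unitSummary B b P X Y with hVdef
  have hV : ∀ i, Measurable (V i) := hmod.measurable_unitSummary h𝒦 hB.measurable b
  have hind : iIndepFun V μ := hmod.iIndepFun_unitSummary h𝒦 hB.measurable b
  set δ : Distn 𝒦 × ℝ × ℝ → Distn 𝒦 × ℝ × ℝ → ℝ := fun u v => D u.1 v.1 with hδdef
  have hδ : Measurable (Function.uncurry δ) := by
    have h1 : Measurable fun z : (Distn 𝒦 × ℝ × ℝ) × (Distn 𝒦 × ℝ × ℝ) => (z.1.1, z.2.1) := by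
      fun_prop
    exact (measurable_D h𝒦).comp h1
  set d : Ω → Fin m → ℝ := fun ω j => D (P j.castSucc ω) (P (Fin.last m) ω) with hd
  set e : Fin (m + 1) → Ω → ℝ := fun i ω =>
    L1dist (kde B b fun j => X i j ω) (P i ω).density with he
  set I := invSmallBall ν (r * h) with hI
  have hπ : ∀ (i : Fin (m + 1)) (q : Distn 𝒦 × ℝ × ℝ),
      μ {ω | δ (V i ω) q ≤ r * h} = smallBall ν q.1 (r * h) :=
    fun i q => hmod.measure_D_le h𝒦 (r * h) i q.1
  have hΦ := (measurable_smallBall h𝒦 ν (r * h)).inv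
  have hem : ∀ i, Measurable fun ω => ENNReal.ofReal (e i ω) := fun i =>
    (measurable_fst.comp (measurable_snd.comp (hV i))).ennreal_ofReal
  have hdm : Measurable d := measurable_pi_lambda _ fun j => (measurable_D h𝒦).comp
    ((hmod.measurable_P j.castSucc).prodMk (hmod.measurable_P (Fin.last m)))
  have hsm : ∀ i, Measurable fun ω => invRank (r * h) (d ω) i := fun i =>
    (measurable_invRank (r * h) i).comp hdm
  have hsum : ∫⁻ ω, ∑ i, invRank (r * h) (d ω) i ∂μ ≤ I := by
    have h1 := lintegral_last_mul_sum_invRank_le hV hind hδ hπ (φ := fun _ => 1) measurable_const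
    simp only [one_mul] at h1
    refine h1.trans_eq ?_
    have h2 := lintegral_map (μ := μ) hΦ (hmod.measurable_P (Fin.last m))
    rw [hmod.map_P] at h2
    exact h2.symm
  -- Given the new unit, the sum of inverse ranks costs `1 / Φ`. This depends on its distribution
  -- only, so the density error can then be averaged given that distribution.
  have hlast : ∫⁻ ω, ENNReal.ofReal (e (Fin.last m) ω) * ∑ i, invRank (r * h) (d ω) i ∂μ ≤
      a * I := by
    have h1 := lintegral_last_mul_sum_invRank_le hV hind hδ hπ
      (φ := fun u => ENNReal.ofReal u.2.1) measurable_snd.fst.ennreal_ofReal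
    exact h1.trans (hmod.lintegral_error_mul_le h𝒦 hB.measurable (Fin.last m) (ha _) hΦ)
  have htrain : ∫⁻ ω, ∑ i : Fin m, ENNReal.ofReal (e i.castSucc ω) * invRank (r * h) (d ω) i ∂μ ≤
      a * I := by
    rw [lintegral_finsetSum _ fun i _ => (hem i.castSucc).fun_mul (hsm i)]
    calc ∑ i : Fin m, ∫⁻ ω, ENNReal.ofReal (e i.castSucc ω) * invRank (r * h) (d ω) i ∂μ
        ≤ ∑ i : Fin m, a * ∫⁻ ω, invRank (r * h) (d ω) i ∂μ := by
          refine Finset.sum_le_sum fun i _ => ?_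
          refine (lintegral_castSucc_mul_invRank hV hind hδ (φ := fun u => ENNReal.ofReal u.2.1)
            measurable_snd.fst.ennreal_ofReal i).trans_le ?_
          have h1 := hmod.lintegral_error_mul_le h𝒦 hB.measurable i.castSucc (ha _)
            (G := fun _ => 1) measurable_const
          simp only [mul_one, lintegral_const, measure_univ] at h1
          exact mul_le_mul_left h1 _
      _ = a * ∫⁻ ω, ∑ i, invRank (r * h) (d ω) i ∂μ := by
          rw [← Finset.mul_sum, lintegral_finsetSum _ fun i _ => hsm i]
      _ ≤ a * I := by gcongr
  -- The expectations sum to at most `I`, so one of the `m` is at most the average. This index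
  -- supplies the factor `1 / m` for the noise and for the event of no neighbours.
  obtain ⟨i₀, hi₀⟩ : ∃ i₀, ∫⁻ ω, invRank (r * h) (d ω) i₀ ∂μ ≤ I / m := by
    rw [lintegral_finsetSum _ fun i _ => hsm i] at hsum
    have hne : (Finset.univ : Finset (Fin m)).Nonempty := ⟨⟨0, hm⟩, Finset.mem_univ _⟩
    by_contra! hlt
    have h1 := ENNReal.sum_lt_sum_of_nonempty hne fun i _ => hlt i
    rw [Finset.sum_const, Finset.card_univ, Fintype.card_fin, nsmul_eq_mul,
      ENNReal.mul_div_cancel (by exact_mod_cast hm.ne') (ENNReal.natCast_ne_top m)] at h1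
    exact h1.not_ge hsum
  have hd0 : ∀ ω j, 0 ≤ d ω j := fun ω j => L1dist_nonneg _ _
  have hK0 : ∀ ω j, 0 ≤ K (d ω j / h) := fun ω j => hK.nonneg _ (div_nonneg (hd0 ω j) hh.le)
  have hξ : ∀ i, ∀ᵐ ω ∂μ, |Y i ω - f (P i ω)| ≤ M + F := fun i => by
    filter_upwards [hM i, hmod.ae_of_ae i hF] with ω h1 h2
    exact (abs_sub _ _).trans (add_le_add h1 h2)
  have hnoise : ∫⁻ ω, ENNReal.ofReal |∑ i : Fin m, (Y i.castSucc ω - f (P i.castSucc ω)) *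
      regWeight K h (r * h) (d ω) i| ∂μ ≤
      ENNReal.ofReal (M + F) * (ENNReal.ofReal (2 / κ) * (I / m)) ^ (1 / 2 : ℝ) := by
    have hdx : Measurable fun (x : Fin (m + 1) → Distn 𝒦) (j : Fin m) =>
        D (x j.castSucc) (x (Fin.last m)) := by
      refine measurable_pi_lambda _ fun j => ?_
      have h1 : Measurable fun x : Fin (m + 1) → Distn 𝒦 => (x j.castSucc, x (Fin.last m)) := by
        fun_prop
      exact (measurable_D h𝒦).comp h1
    have hKx : ∀ (x : Fin (m + 1) → Distn 𝒦) (j : Fin m),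
        0 ≤ K (D (x j.castSucc) (x (Fin.last m)) / h) :=
      fun x j => hK.nonneg _ (div_nonneg (L1dist_nonneg _ _) hh.le)
    have hξm : Measurable fun u : Distn 𝒦 × ℝ × ℝ => u.2.2 - f u.1 :=
      measurable_snd.snd.sub (hf.comp measurable_fst)
    -- Orthogonality applies because the oracle weights are functions of the distributions alone;
    -- weights built from the samples would not qualify.
    have h1 := lintegral_abs_sum_noise_le (μ := μ) hV hind hξm measurable_fst
      (add_nonneg hM0 hF0) hξ
      (fun i G hG hG1 => hmod.integral_noise_mul_eq_zero hf i (hξ i) hG hG1)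
      Fin.castSuccEmb
      (w := fun i x => regWeight K h (r * h) (fun j => D (x j.castSucc) (x (Fin.last m))) i)
      (fun i => (measurable_regWeight hKm h (r * h) i).comp hdx)
      (fun i x => by
        rw [abs_of_nonneg (regWeight_nonneg (hKx x) i)]
        exact regWeight_le_one (hKx x) i)
    refine h1.trans ?_
    gcongr
    calc _ ≤ ∫⁻ ω, ENNReal.ofReal (2 / κ) * invRank (r * h) (d ω) i₀ ∂μ :=
          lintegral_mono fun ω => sum_regWeight_sq_le hK hκ hr hh (hd0 ω) i₀
      _ = ENNReal.ofReal (2 / κ) * ∫⁻ ω, invRank (r * h) (d ω) i₀ ∂μ :=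
          lintegral_const_mul _ (hsm i₀)
      _ ≤ _ := by gcongr
  have hdensity := fun Q : Distn 𝒦 => Q.integrable_density
  have hkde := fun i ω => integrable_kde (N := N i) hB.measurable hb hBmax hρ fun j => X i j ω
  have hpt : ∀ᵐ ω ∂μ, ENNReal.ofReal |kernelKernel K B h b (fun i j => X i j ω) (fun i => Y i ω) -
        f (P (Fin.last m) ω)| ≤
      ENNReal.ofReal (4 * M * LK / (κ * h)) *
          ((∑ i : Fin m, ENNReal.ofReal (e i.castSucc ω) * invRank (r * h) (d ω) i) +
            ENNReal.ofReal (e (Fin.last m) ω) * ∑ i, invRank (r * h) (d ω) i) +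
        ENNReal.ofReal (L * R ^ β * h ^ β) +
        ENNReal.ofReal |∑ i : Fin m, (Y i.castSucc ω - f (P i.castSucc ω)) *
          regWeight K h (r * h) (d ω) i| +
        ENNReal.ofReal (M + F) * invRank (r * h) (d ω) i₀ := by
    filter_upwards [ae_all_iff.2 hM, hmod.ae_of_ae (Fin.last m) hF] with ω hYω hfω
    exact ofReal_abs_kernelRegression_sub_le hK hκ hr hR hh hM0 hL hβ (hd0 ω)
      (fun i => L1dist_nonneg _ _)
      (fun i => abs_L1dist_sub_L1dist_le (hdensity _) (hkde _ ω) (hdensity _) (hkde _ ω))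
      (fun i => L1dist_nonneg _ _) (L1dist_nonneg _ _) (fun i => hYω i.castSucc) hfω
      (fun i => hfL _ _) i₀
  refine (lintegral_mono_ae hpt).trans ?_
  have hm1 : Measurable fun ω =>
      ∑ i : Fin m, ENNReal.ofReal (e i.castSucc ω) * invRank (r * h) (d ω) i :=
    Finset.measurable_fun_sum _ fun i _ => (hem i.castSucc).fun_mul (hsm i)
  have hm2 : Measurable fun ω =>
      ENNReal.ofReal (e (Fin.last m) ω) * ∑ i, invRank (r * h) (d ω) i :=
    (hem (Fin.last m)).fun_mul (Finset.measurable_fun_sum _ fun i _ => hsm i)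
  have hm3 := (hm1.fun_add hm2).const_mul (ENNReal.ofReal (4 * M * LK / (κ * h)))
  rw [lintegral_add_right _ ((hsm i₀).const_mul _), lintegral_const_mul _ (hsm i₀)]
  refine add_le_add ?_ (by gcongr)
  rw [lintegral_add_left (hm3.fun_add measurable_const)]
  refine add_le_add ?_ hnoise
  rw [lintegral_add_right _ measurable_const, lintegral_const, measure_univ, mul_one,
    lintegral_const_mul _ (hm1.fun_add hm2), lintegral_add_left hm1]
  gcongr

theorem kernelKernel_comp_max {h b : ℝ} (hh : 0 ≤ h) (X : (i : Fin (m + 1)) → Fin (N i) → E k)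
    (y : Fin (m + 1) → ℝ) :
    kernelKernel (fun x => K (max x 0)) B h b X y = kernelKernel K B h b X y := by
  have h0 : ∀ p q : E k → ℝ, max (L1dist p q / h) 0 = L1dist p q / h := fun p q =>
    max_eq_left (div_nonneg (L1dist_nonneg p q) hh)
  simp only [kernelKernel, kernelRegression, h0]

/-- The bandwidth is the one at which the variance order `1 / (n * b ^ k)` equals `b ^ 2`. -/
theorem natCast_mul_rpow_pow {n : ℕ} (hn : 1 ≤ n) (k : ℕ) :
    (n : ℝ) * ((n : ℝ) ^ (-(1 / (2 + (k : ℝ))))) ^ (k + 2) = 1 := by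
  have hn0 : (0 : ℝ) < n := by exact_mod_cast hn
  rw [← Real.rpow_natCast, ← Real.rpow_mul hn0.le]
  have : -(1 / (2 + (k : ℝ))) * ((k + 2 : ℕ) : ℝ) = -1 := by
    push_cast
    field_simp
    ring
  rw [this, Real.rpow_neg_one, mul_inv_cancel₀ hn0.ne']

end Risk

end DistReg

/-! ### The risk bound with explicit constants -/

theorem theorem1 {k : ℕ} (hk : 1 ≤ k) {𝒦 : Set (DistReg.E k)} (h𝒦 : IsCompact 𝒦)
    (Λ : ℝ≥0) (B : ℝ → ℝ) (hB : DistReg.IsSmoothingKernel k B)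
    (LK : ℝ≥0) (κ r R : ℝ) (hκ : 0 < κ) (hκ1 : κ < 1) (hr : 0 < r) (hrR : r < R)
    (L β fmax BY Cstar : ℝ) (hL : 0 < L) (hβ : 0 < β) (hβ1 : β ≤ 1) (hfmax : 0 < fmax)
    (hCstar : 0 < Cstar) :
    ∃ C₁ C₂ C₃ C₄ : ℝ, 0 < C₁ ∧ 0 < C₂ ∧ 0 < C₃ ∧ 0 < C₄ ∧
      ∀ (K : ℝ → ℝ), DistReg.IsBoxedKernel K LK κ r R →
      ∀ (ν : Measure (DistReg.Distn 𝒦)) [IsProbabilityMeasure ν],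
        (∀ᵐ Q ∂ν, DistReg.HasHolderDensity Λ Q) →
      ∀ (f : DistReg.Distn 𝒦 → ℝ), Measurable f → DistReg.IsHolderFunctional L β f →
        (∀ᵐ Q ∂ν, |f Q| ≤ fmax) →
      ∀ (m n : ℕ) (N : Fin (m + 1) → ℕ) (h : ℝ), 1 ≤ m → 1 ≤ n → IsLeast (Set.range N) n →
        0 < h → Cstar * (n : ℝ) ^ (-(1 / (2 + (k : ℝ)))) ≤ r * h / 4 →
      ∀ {Ω : Type*} [MeasurableSpace Ω] (μ : Measure Ω) [IsProbabilityMeasure μ]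
        (P : Fin (m + 1) → Ω → DistReg.Distn 𝒦)
        (X : (i : Fin (m + 1)) → Fin (N i) → Ω → DistReg.E k) (Y : Fin (m + 1) → Ω → ℝ),
        DistReg.IsModel μ ν f N P X Y →
        (∀ i, ∀ᵐ ω ∂μ, |Y i ω| ≤ BY) →
        ∫⁻ ω, ENNReal.ofReal
            |DistReg.kernelKernel K B h ((n : ℝ) ^ (-(1 / (2 + (k : ℝ)))))
                (fun i j => X i j ω) (fun i => Y i ω) - f (P (Fin.last m) ω)| ∂μ
          ≤ ENNReal.ofReal (1 / h * (C₁ * (n : ℝ) ^ (-(1 / (2 + (k : ℝ))))))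
                * DistReg.invSmallBall ν (r * h / 2)
            + ENNReal.ofReal (C₂ * h ^ β)
            + ENNReal.ofReal (C₃ * √(1 / (m : ℝ)))
                * DistReg.invSmallBall ν (r * h / 2) ^ (1 / 2 : ℝ)
            + ENNReal.ofReal (C₄ / m) * DistReg.invSmallBall ν (r * h / 2)
            + ENNReal.ofReal
                ((m + 1) * Real.exp (-(1 / 2 * (n : ℝ) ^ ((k : ℝ) / (2 + (k : ℝ)))))) := by
  obtain ⟨C, hC, hkde⟩ := DistReg.exists_lintegral_L1dist_kde_le h𝒦 Λ hB
  have hR : 0 < R := hr.trans hrR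
  have hM := abs_nonneg BY
  -- The factor `8` is `4` from the stability bound times `2`, for the training and new density
  -- errors. The `+ 1` keeps the constant positive when `BY` or `LK` is zero; `|BY|` is used because
  -- `BY` carries no sign assumption.
  refine ⟨8 * |BY| * LK * C / κ + 1, L * R ^ β, (|BY| + fmax) * √(2 / κ), |BY| + fmax,
    by positivity, by positivity, by positivity, by positivity, ?_⟩
  intro K hK ν _ hν f hf hfL hfF m n N h hm hn hN hh _ Ω _ μ _ P X Y hmod hY
  obtain ⟨b, hbdef⟩ : ∃ b, b = (n : ℝ) ^ (-(1 / (2 + (k : ℝ)))) := ⟨_, rfl⟩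
  rw [← hbdef]
  have hn0 : (0 : ℝ) < n := by exact_mod_cast hn
  have hb : 0 < b := hbdef ▸ Real.rpow_pos_of_pos hn0 _
  have hb1 : b ≤ 1 := by
    rw [hbdef]
    exact Real.rpow_le_one_of_one_le_of_nonpos (by exact_mod_cast hn)
      (by rw [neg_nonpos]; positivity)
  -- Equality holds at the smallest sample size `n`; larger samples only help.
  have hNb : ∀ i, 1 ≤ N i * b ^ (k + 2) := fun i => by
    rw [← DistReg.natCast_mul_rpow_pow hn k, ← hbdef]
    gcongr
    exact hN.2 ⟨i, rfl⟩
  have hrisk := hmod.lintegral_abs_kernelKernel_sub_le h𝒦 hB hK.comp_max hK.measurable_comp_max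
    hκ hr hR.le hf hL.le hβ.le hfL hfmax.le hfF hM
    (fun i => (hY i).mono fun ω h1 => h1.trans (le_abs_self BY)) hm hh hb
    (a := ENNReal.ofReal (C * b))
    (fun i => hν.mono fun Q hQ => hkde Q hQ (N i) b hb hb1 (hNb i))
  simp only [DistReg.kernelKernel_comp_max hh.le] at hrisk
  -- The argument works with radius `r * h`; the smaller ball in the claim only enlarges the inverse
  -- probability.
  have hI : DistReg.invSmallBall ν (r * h) ≤ DistReg.invSmallBall ν (r * h / 2) :=
    DistReg.invSmallBall_anti ν (by linarith [mul_pos hr hh])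
  set I := DistReg.invSmallBall ν (r * h / 2) with hIdef
  have hm0 : (0 : ℝ) < m := by exact_mod_cast hm
  have hdiv : I / m = ENNReal.ofReal (1 / (m : ℝ)) * I := by
    rw [one_div, ENNReal.ofReal_inv_of_pos hm0, ENNReal.ofReal_natCast, mul_comm,
      ENNReal.div_eq_inv_mul, mul_comm]
  have hsqrt : (ENNReal.ofReal (2 / κ) * (I / m)) ^ (1 / 2 : ℝ) =
      ENNReal.ofReal (√(2 / κ) * √(1 / (m : ℝ))) * I ^ (1 / 2 : ℝ) := by
    rw [hdiv, ← mul_assoc, ← ENNReal.ofReal_mul (by positivity),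
      ENNReal.mul_rpow_of_nonneg _ _ (by norm_num),
      ENNReal.ofReal_rpow_of_nonneg (by positivity) (by norm_num), ← Real.sqrt_eq_rpow,
      Real.sqrt_mul (by positivity)]
  -- The exponential summand is pure slack: density errors were bounded in expectation, not on an
  -- event of high probability.
  refine hrisk.trans (le_add_of_le_of_nonneg ?_ zero_le)
  refine add_le_add (add_le_add (add_le_add ?_ le_rfl) ?_) ?_
  · rw [← two_mul, ← mul_assoc, ← mul_assoc, ← ENNReal.ofReal_ofNat,
      ← ENNReal.ofReal_mul (by positivity), ← ENNReal.ofReal_mul (by positivity)]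
    refine mul_le_mul' (ENNReal.ofReal_le_ofReal ?_) hI
    have h1 : 4 * |BY| * LK / (κ * h) * 2 * (C * b) =
        1 / h * (8 * |BY| * LK * C / κ * b) := by
      field_simp
      ring
    rw [h1]
    gcongr
    linarith
  · calc _ ≤ ENNReal.ofReal (|BY| + fmax) *
          (ENNReal.ofReal (2 / κ) * (I / m)) ^ (1 / 2 : ℝ) := by gcongr
      _ = _ := by
          rw [hsqrt, ← mul_assoc, ← ENNReal.ofReal_mul (by positivity), mul_assoc (|BY| + fmax)]
  · calc _ ≤ ENNReal.ofReal (|BY| + fmax) * (I / m) := by gcongr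
      _ = _ := by
          rw [hdiv, ← mul_assoc, ← ENNReal.ofReal_mul (by positivity), mul_one_div]
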